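/- Let $k$ be a field, $Q=(Q_0,Q_1,s,e)$ a quiver with finitely many vertices, $kQ$ its path algebra (paths are composed from right to left, and modules are left modules), and $I\subseteq kQ$ an ideal such that $A=kQ/I$ is gentle. That is: $I$ is generated by a set of paths of length at least two and is admissible ($R^m\subseteq I\subseteq R^2$ for some $m\ge 2$, where $R$ is the arrow ideal); every vertex has at most two incoming and at most two outgoing arrows; for every arrow $\alpha$ there is at most one arrow $\beta$ with $\alpha\beta\notin I$ and at most one arrow $\gamma$ with $\gamma\alpha\notin I$; $I$ is generated by a set of paths of length two; and for every arrow $\alpha$ there is at most one arrow $\beta$ with $0\neq\alpha\beta\in I$ and at most one arrow $\gamma$ with $0\ne\gamma\alpha\in I$. A string $C=\gamma_n\cdots\gamma_1$ ($n\ge 0$) is a walk in $Q$, each $\gamma_i$ being an arrow ("direct") or the formal inverse of an arrow ("inverse"), such that no letter is followed by its inverse and neither $C$ nor $C^{-1}$ contains a path that lies in $I$; for every vertex there is a lazy string of length $0$. The string module $M(C)$ has one basis vector for each of the $n+1$ positions of $C$; a trivial path $e_x$ acts as the projection onto the basis vectors at positions lying over the vertex $x$, and an arrow $\alpha$ acts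 by identity maps along all occurrences of $\alpha$ and $\alpha^{-1}$ in $C$ and by zero elsewhere. A factorization $C=FED$ into strings is a *quotient factorization* if $D$ is lazy or $D=\gamma D'$ with $\gamma$ inverse, and $F$ is lazy or $F=F'\theta$ with $\theta$ direct; it is a *submodule factorization* if $D$ is lazy or $D=\gamma D'$ with $\gamma$ direct, and $F$ is lazy or $F=F'\theta$ with $\theta$ inverse. A string $E$ is a *factor* of $C$ if $E$ or $E^{-1}$ is the middle term of a quotient factorization of $C$. For a module $X$, let $\operatorname{Fac}X$ be the class of finitely generated $A$-modules that are quotients of finite direct sums of copies of $X$. **Theorem.** Let $(X_i)_{i\in J}$ be a family of strings, let $X=\bigoplus_{i\in J}M(X_i)$, and let $Y$ be a string. Then $M(Y)\in\operatorname{Fac}X$ if and only if $Y$ is a union of substrings each of which is a submodule of $Y$ and a factor of some $X_i$; that is, if and only if there is a set $\mathcal S$ of submodule factorizations $Y=FED$ such that for each of them the string $E$ is a factor of some $X_i$, and such that every position (vertex) and every arrow of $Y$ lies in the middle part $E$ of at least one factorization in $\mathcal S$. -/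

import Mathlib

namespace GentleStrings

open Quiver

universe u v w

/-! ### The path algebra of a quiver -/

/-- A path of the quiver `V`, together with its end points; the trivial paths are included. -/
structure QPath (V : Type u) [Quiver.{v} V] where
  src : V
  tgt : V
  path : Quiver.Path src tgt

/-- The path algebra `kQ`: the vector space with basis the paths of the quiver. -/
def PathAlgebra (k : Type w) (V : Type u) [Field k] [Quiver.{v} V] : Type (max u v w) :=
  QPath V →₀ k

namespace PathAlgebra

section

variable {k : Type w} {V : Type u} [Field k] [Quiver.{v} V]

noncomputable instance : AddCommGroup (PathAlgebra k V) :=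
  inferInstanceAs (AddCommGroup (QPath V →₀ k))

noncomputable instance : Module k (PathAlgebra k V) :=
  inferInstanceAs (Module k (QPath V →₀ k))

variable (k) in
/-- The basis element of the path algebra given by a path. -/
noncomputable def ofPath (p : QPath V) : PathAlgebra k V :=
  (Finsupp.single p 1 : QPath V →₀ k)

variable (k) in
/-- The linear map out of the path algebra with prescribed values on paths. -/
noncomputable def lin {M : Type*} [AddCommMonoid M] [Module k M] (f : QPath V → M) :
    PathAlgebra k V →ₗ[k] M :=
  Finsupp.linearCombination k f

@[simp] theorem lin_ofPath {M : Type*} [AddCommMonoid M] [Module k M] (f : QPath V → M)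
    (p : QPath V) : lin k f (ofPath k p) = f p :=
  (Finsupp.linearCombination_single k 1 p).trans (one_smul k (f p))

theorem hom_ext {M : Type*} [AddCommMonoid M] [Module k M] {f g : PathAlgebra k V →ₗ[k] M}
    (h : ∀ p, f (ofPath k p) = g (ofPath k p)) : f = g :=
  Finsupp.lhom_ext' fun p => LinearMap.ext_ring (h p)

open Classical in
variable (k) in
/-- The product `p * q` of two paths, read from right to left: the path "first `q`, then `p`"
if `q` ends where `p` starts, and `0` otherwise. -/
noncomputable def pathMul (p q : QPath V) : PathAlgebra k V :=
  if h : p.src = q.tgt then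
    ofPath k ⟨q.src, p.tgt, q.path.comp (Quiver.Path.cast h rfl p.path)⟩
  else 0

theorem pathMul_comp {a b c : V} (p : Quiver.Path b c) (q : Quiver.Path a b) :
    pathMul k ⟨b, c, p⟩ ⟨a, b, q⟩ = ofPath k ⟨a, c, q.comp p⟩ := by
  simp [pathMul]

theorem pathMul_of_ne {p q : QPath V} (h : p.src ≠ q.tgt) : pathMul k p q = 0 := by
  simp [pathMul, h]

variable (k V) in
/-- The bilinear extension of the product of paths. -/
noncomputable def mulLin : PathAlgebra k V →ₗ[k] PathAlgebra k V →ₗ[k] PathAlgebra k V :=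
  lin k fun p => lin k fun q => pathMul k p q

noncomputable instance : Mul (PathAlgebra k V) := ⟨fun x y => mulLin k V x y⟩

theorem mul_def (x y : PathAlgebra k V) : x * y = mulLin k V x y := rfl

@[simp] theorem ofPath_mul (p q : QPath V) : ofPath k p * ofPath k q = pathMul k p q := by
  simp [mul_def, mulLin]

theorem mul_assoc_ofPath (p q r : QPath V) :
    ofPath k p * ofPath k q * ofPath k r = ofPath k p * (ofPath k q * ofPath k r) := by
  obtain ⟨p₁, p₂, p⟩ := p
  obtain ⟨q₁, q₂, q⟩ := q
  obtain ⟨r₁, r₂, r⟩ := r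
  simp only [ofPath_mul]
  by_cases h : p₁ = q₂ <;> by_cases h' : q₁ = r₂
  · subst h; subst h'
    simp [pathMul_comp]
  · subst h
    rw [pathMul_of_ne (p := ⟨q₁, _, q⟩) (q := ⟨r₁, r₂, r⟩) h', pathMul_comp, ofPath_mul,
      pathMul_of_ne h']
    simp [mul_def]
  · subst h'
    rw [pathMul_of_ne (p := ⟨p₁, _, p⟩) (q := ⟨q₁, _, q⟩) h, pathMul_comp, ofPath_mul,
      pathMul_of_ne h]
    simp [mul_def]
  · rw [pathMul_of_ne (p := ⟨p₁, _, p⟩) (q := ⟨q₁, _, q⟩) h,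
      pathMul_of_ne (p := ⟨q₁, _, q⟩) (q := ⟨r₁, r₂, r⟩) h']
    simp [mul_def]

theorem mul_assoc_aux (x y z : PathAlgebra k V) : x * y * z = x * (y * z) := by
  have h1 : ∀ (p q : QPath V) (z : PathAlgebra k V),
      ofPath k p * ofPath k q * z = ofPath k p * (ofPath k q * z) := fun p q z =>
    LinearMap.congr_fun (f := mulLin k V (mulLin k V (ofPath k p) (ofPath k q)))
      (g := (mulLin k V (ofPath k p)).comp (mulLin k V (ofPath k q)))
      (hom_ext fun r => mul_assoc_ofPath p q r) z
  have h2 : ∀ (p : QPath V) (y z : PathAlgebra k V),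
      ofPath k p * y * z = ofPath k p * (y * z) := fun p y z =>
    LinearMap.congr_fun (f := ((mulLin k V).flip z).comp (mulLin k V (ofPath k p)))
      (g := (mulLin k V (ofPath k p)).comp ((mulLin k V).flip z))
      (hom_ext fun q => h1 p q z) y
  exact LinearMap.congr_fun (f := ((mulLin k V).flip z).comp ((mulLin k V).flip y))
      (g := (mulLin k V).flip (mulLin k V y z))
      (hom_ext fun p => h2 p y z) x

variable [Fintype V]

/-- The unit of the path algebra is the sum of all trivial paths. -/
noncomputable instance : One (PathAlgebra k V) := ⟨∑ x : V, ofPath k ⟨x, x, Quiver.Path.nil⟩⟩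

theorem one_def : (1 : PathAlgebra k V) = ∑ x : V, ofPath k ⟨x, x, Quiver.Path.nil⟩ := rfl

theorem one_mul_aux (x : PathAlgebra k V) : 1 * x = x := by
  have key : mulLin k V 1 = LinearMap.id := by
    refine hom_ext fun p => ?_
    obtain ⟨a, b, p⟩ := p
    rw [LinearMap.id_apply, one_def, map_sum, LinearMap.sum_apply, Finset.sum_eq_single b]
    · rw [← mul_def, ofPath_mul, pathMul_comp, Quiver.Path.comp_nil]
    · intro c _ hc
      rw [← mul_def, ofPath_mul, pathMul_of_ne hc]
    · simp
  exact LinearMap.congr_fun key x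

theorem mul_one_aux (x : PathAlgebra k V) : x * 1 = x := by
  have key : (mulLin k V).flip 1 = LinearMap.id := by
    refine hom_ext fun p => ?_
    obtain ⟨a, b, p⟩ := p
    rw [LinearMap.id_apply, LinearMap.flip_apply, one_def, map_sum, Finset.sum_eq_single a]
    · rw [← mul_def, ofPath_mul, pathMul_comp, Quiver.Path.nil_comp]
    · intro c _ hc
      rw [← mul_def, ofPath_mul, pathMul_of_ne (Ne.symm hc)]
    · simp
  exact LinearMap.congr_fun key x

noncomputable instance : Ring (PathAlgebra k V) :=
  { (inferInstance : AddCommGroup (PathAlgebra k V)),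
    (inferInstance : Mul (PathAlgebra k V)),
    (inferInstance : One (PathAlgebra k V)) with
    left_distrib := fun x y z => by simp [mul_def]
    right_distrib := fun x y z => by simp [mul_def]
    zero_mul := fun x => by simp [mul_def]
    mul_zero := fun x => by simp [mul_def]
    mul_assoc := mul_assoc_aux
    one_mul := one_mul_aux
    mul_one := mul_one_aux }

noncomputable instance : Algebra k (PathAlgebra k V) :=
  Algebra.ofModule (fun r x y => by simp [mul_def]) (fun r x y => by simp [mul_def])

variable (k) in
/-- An arrow, as an element of the path algebra. -/
noncomputable def ofArrow (α : Quiver.Total V) : PathAlgebra k V :=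
  ofPath k ⟨α.left, α.right, α.hom.toPath⟩

variable (k V) in
/-- The arrow ideal of the path algebra. -/
noncomputable def arrowIdeal : TwoSidedIdeal (PathAlgebra k V) :=
  TwoSidedIdeal.span (Set.range (ofArrow k))

end

end PathAlgebra

open PathAlgebra

/-! ### String algebras and gentle algebras -/

section

variable {k : Type w} {V : Type u} [Field k] [Quiver.{v} V] [Fintype V]

/-- `I` is an admissible ideal of `kQ` generated by a set of zero relations, that is, by a set of
paths of length at least two. -/
class IsAdmissibleMonomial (I : TwoSidedIdeal (PathAlgebra k V)) : Prop where
  generated : ∃ S : Set (QPath V), (∀ p ∈ S, 2 ≤ p.path.length) ∧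
    I = TwoSidedIdeal.span (ofPath k '' S)
  admissible : ∃ m : ℕ, 2 ≤ m ∧ (arrowIdeal k V).asIdeal ^ m ≤ I.asIdeal ∧
    I.asIdeal ≤ (arrowIdeal k V).asIdeal ^ 2

/-- The bound quiver `(V, I)` defines a string algebra `kQ/I`. -/
class IsStringAlgebra (I : TwoSidedIdeal (PathAlgebra k V)) : Prop
    extends IsAdmissibleMonomial I where
  incoming_le : ∀ x : V, {α : Quiver.Total V | α.right = x}.encard ≤ 2
  outgoing_le : ∀ x : V, {α : Quiver.Total V | α.left = x}.encard ≤ 2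
  right_unique : ∀ α β β' : Quiver.Total V,
    ofArrow k α * ofArrow k β ∉ I → ofArrow k α * ofArrow k β' ∉ I → β = β'
  left_unique : ∀ α γ γ' : Quiver.Total V,
    ofArrow k γ * ofArrow k α ∉ I → ofArrow k γ' * ofArrow k α ∉ I → γ = γ'

/-- The bound quiver `(V, I)` defines a gentle algebra `kQ/I`. -/
class IsGentle (I : TwoSidedIdeal (PathAlgebra k V)) : Prop
    extends IsStringAlgebra I where
  quadratic : ∃ S : Set (QPath V), (∀ p ∈ S, p.path.length = 2) ∧
    I = TwoSidedIdeal.span (ofPath k '' S)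
  right_relation_unique : ∀ α β β' : Quiver.Total V,
    ofArrow k α * ofArrow k β ≠ 0 → ofArrow k α * ofArrow k β ∈ I →
    ofArrow k α * ofArrow k β' ≠ 0 → ofArrow k α * ofArrow k β' ∈ I → β = β'
  left_relation_unique : ∀ α γ γ' : Quiver.Total V,
    ofArrow k γ * ofArrow k α ≠ 0 → ofArrow k γ * ofArrow k α ∈ I →
    ofArrow k γ' * ofArrow k α ≠ 0 → ofArrow k γ' * ofArrow k α ∈ I → γ = γ'

/-- The algebra `A = kQ/I`. -/
abbrev BoundAlgebra (I : TwoSidedIdeal (PathAlgebra k V)) : Type (max u v w) :=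
  PathAlgebra k V ⧸ I.asIdeal

end

/-! ### Strings -/

section

variable {V : Type u} [Quiver.{v} V]

/-- An arrow of the double quiver: an arrow of the quiver or the formal inverse of one. -/
inductive Letter (V : Type u) [Quiver.{v} V] where
  | direct (α : Quiver.Total V)
  | inverse (α : Quiver.Total V)

namespace Letter

def src : Letter V → V
  | direct α => α.left
  | inverse α => α.right

def tgt : Letter V → V
  | direct α => α.right
  | inverse α => α.left

/-- The formal inverse of a letter. -/
def inv : Letter V → Letter V
  | direct α => inverse α
  | inverse α => direct α

def IsDirect (x : Letter V) : Prop := ∃ α, x = direct α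

def IsInverse (x : Letter V) : Prop := ∃ α, x = inverse α

@[simp] theorem src_inv (x : Letter V) : x.inv.src = x.tgt := by cases x <;> rfl

@[simp] theorem inv_inv (x : Letter V) : x.inv.inv = x := by cases x <;> rfl

@[simp] theorem tgt_inv (x : Letter V) : x.inv.tgt = x.src := by cases x <;> rfl

end Letter

/-- A path in the double quiver. The head of the list `letters` is the letter that is traversed
first, so `γₙ ⋯ γ₁` has the list of letters `[γ₁, …, γₙ]`. -/
@[ext] structure Walk (V : Type u) [Quiver.{v} V] where
  start : V
  letters : List (Letter V)
  composable : letters.IsChain (fun x y => x.tgt = y.src)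
  start_eq : ∀ x ∈ letters.head?, x.src = start

namespace Walk

def length (C : Walk V) : ℕ := C.letters.length

/-- The vertices that the walk passes through, in order. -/
def vertices (C : Walk V) : List V := C.start :: C.letters.map Letter.tgt

theorem length_vertices (C : Walk V) : C.vertices.length = C.length + 1 := by
  simp [vertices, length]

/-- The vertex at the `i`-th position. -/
def vertex (C : Walk V) (i : Fin (C.length + 1)) : V :=
  C.vertices[i.val]'(by rw [length_vertices]; exact i.isLt)

/-- The vertex where the walk ends. -/
def finish (C : Walk V) : V := C.vertex (Fin.last _)

theorem finish_eq_of_getLast? (C : Walk V) {x : Letter V} (h : x ∈ C.letters.getLast?) :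
    x.tgt = C.finish := by
  obtain ⟨s, l, hc, hs⟩ := C
  rcases List.eq_nil_or_concat l with rfl | ⟨l', y, rfl⟩
  · simp at h
  · simp at h
    subst h
    simp [finish, vertex, vertices, length]

/-- The inverse walk. -/
def inv (C : Walk V) : Walk V where
  start := C.finish
  letters := (C.letters.map Letter.inv).reverse
  composable := by
    rw [List.isChain_reverse, List.isChain_map]
    exact C.composable.imp fun x y h => by simpa using h.symm
  start_eq := by
    intro x hx
    rw [List.head?_reverse, List.getLast?_map] at hx
    obtain ⟨y, hy, rfl⟩ := Option.mem_map.1 hx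
    rw [Letter.src_inv]
    exact C.finish_eq_of_getLast? hy

/-- In the diagram of the walk there is an arrow labelled `α` from position `i` to position `j`. -/
def HasArrow (C : Walk V) (α : Quiver.Total V) (i j : Fin (C.length + 1)) : Prop :=
  (j.val = i.val + 1 ∧ C.letters[i.val]? = some (Letter.direct α)) ∨
    (i.val = j.val + 1 ∧ C.letters[j.val]? = some (Letter.inverse α))

end Walk

/-- The sequence of arrows of a path of the quiver, as letters of the double quiver. -/
def directLetters {a : V} : ∀ {b : V}, Quiver.Path a b → List (Letter V)
  | _, Quiver.Path.nil => []
  | _, Quiver.Path.cons p α => directLetters p ++ [Letter.direct ⟨_, _, α⟩]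

variable {k : Type w} [Field k] [Fintype V]

/-- `C` is a string of the bound quiver `(V, I)`: no letter is followed by its inverse, and neither
`C` nor its inverse contains a path of the quiver that belongs to `I`. -/
structure IsString (I : TwoSidedIdeal (PathAlgebra k V)) (C : Walk V) : Prop where
  reduced : C.letters.IsChain (fun x y => y ≠ x.inv)
  avoids : ∀ p : QPath V, 1 ≤ p.path.length → ofPath k p ∈ I →
    ¬ directLetters p.path <:+: C.letters ∧ ¬ directLetters p.path <:+: C.inv.letters

/-- The strings of the bound quiver `(V, I)`. -/
def Str (I : TwoSidedIdeal (PathAlgebra k V)) : Type (max u v) := {C : Walk V // IsString I C}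

namespace Str

variable {I : TwoSidedIdeal (PathAlgebra k V)}

/-- The underlying walk. -/
def walk (C : Str I) : Walk V := C.1

def length (C : Str I) : ℕ := C.walk.length

/-- `E₁ ∼ E₂`: the two strings are equal or inverse to each other. -/
def Equivalent (E₁ E₂ : Str I) : Prop := E₁.walk = E₂.walk ∨ E₁.walk = E₂.walk.inv

/-- `C = F E D`, so `D` is traversed first. -/
structure IsFactorization (C F E D : Str I) : Prop where
  start_left : D.walk.start = C.walk.start
  start_mid : E.walk.start = D.walk.finish
  start_right : F.walk.start = E.walk.finish
  letters_eq : C.walk.letters = D.walk.letters ++ E.walk.letters ++ F.walk.letters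

/-- `C = F E D` where `D` is lazy or `D = γ D'` with `γ` inverse, and `F` is lazy or `F = F' θ`
with `θ` direct. -/
structure IsQuotientFactorization (C F E D : Str I) : Prop extends IsFactorization C F E D where
  last_left : ∀ x ∈ D.walk.letters.getLast?, x.IsInverse
  head_right : ∀ x ∈ F.walk.letters.head?, x.IsDirect

/-- `C = F E D` where `D` is lazy or `D = γ D'` with `γ` direct, and `F` is lazy or `F = F' θ`
with `θ` inverse. -/
structure IsSubmoduleFactorization (C F E D : Str I) : Prop extends IsFactorization C F E D where
  last_left : ∀ x ∈ D.walk.letters.getLast?, x.IsDirect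
  head_right : ∀ x ∈ F.walk.letters.head?, x.IsInverse

/-- `E` is, up to inversion, a factor string of `C`. -/
def IsFactor (E C : Str I) : Prop :=
  ∃ F E' D : Str I, IsQuotientFactorization C F E' D ∧ Equivalent E' E

end Str

end

/-! ### String modules -/

section

variable (k : Type w) {V : Type u} [Field k] [Quiver.{v} V]

namespace Walk

open Classical in
/-- The action of an arrow on the string module: the sum of the identity maps along all arrows
of the diagram with that label. -/
noncomputable def arrowMatrix (C : Walk V) (α : Quiver.Total V) :
    Matrix (Fin (C.length + 1)) (Fin (C.length + 1)) k :=
  Matrix.of fun j i => if C.HasArrow α i j then 1 else 0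

open Classical in
/-- The projection onto the basis vectors which lie over the vertex `x`. -/
noncomputable def vertexMatrix (C : Walk V) (x : V) :
    Matrix (Fin (C.length + 1)) (Fin (C.length + 1)) k :=
  Matrix.diagonal fun i => if C.vertex i = x then 1 else 0

/-- The action of a path on the string module. -/
noncomputable def pathMatrix (C : Walk V) {a : V} : ∀ {b : V}, Quiver.Path a b →
    Matrix (Fin (C.length + 1)) (Fin (C.length + 1)) k
  | _, Quiver.Path.nil => C.vertexMatrix k a
  | _, Quiver.Path.cons p α => C.arrowMatrix k ⟨_, _, α⟩ * C.pathMatrix p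

theorem vertex_succ (C : Walk V) {n : ℕ} {x : Letter V} (h : C.letters[n]? = some x)
    (j : Fin (C.length + 1)) (hj : j.val = n + 1) : C.vertex j = x.tgt := by
  obtain ⟨hn, h⟩ := List.getElem?_eq_some_iff.1 h
  simp [vertex, vertices, hj, h]

theorem vertex_of_letter (C : Walk V) {n : ℕ} {x : Letter V} (h : C.letters[n]? = some x)
    (j : Fin (C.length + 1)) (hj : j.val = n) : C.vertex j = x.src := by
  obtain ⟨hn, h⟩ := List.getElem?_eq_some_iff.1 h
  rcases n with _ | n
  · have : x ∈ C.letters.head? := by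
      rw [List.head?_eq_getElem?, List.getElem?_eq_getElem hn, h]; simp
    simp [vertex, vertices, hj, C.start_eq x this]
  · have h1 := List.isChain_iff_getElem.1 C.composable n hn
    rw [h] at h1
    simp [vertex, vertices, hj, h1]

theorem HasArrow.source {C : Walk V} {α : Quiver.Total V} {i j : Fin (C.length + 1)}
    (h : C.HasArrow α i j) : C.vertex i = α.left := by
  rcases h with ⟨h1, h2⟩ | ⟨h1, h2⟩
  · exact C.vertex_of_letter h2 i rfl
  · exact C.vertex_succ h2 i h1

theorem HasArrow.target {C : Walk V} {α : Quiver.Total V} {i j : Fin (C.length + 1)}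
    (h : C.HasArrow α i j) : C.vertex j = α.right := by
  rcases h with ⟨h1, h2⟩ | ⟨h1, h2⟩
  · exact C.vertex_succ h2 j h1
  · exact C.vertex_of_letter h2 j rfl

theorem arrowMatrix_mul_vertexMatrix (C : Walk V) (α : Quiver.Total V) :
    C.arrowMatrix k α * C.vertexMatrix k α.left = C.arrowMatrix k α := by
  ext j i
  rw [vertexMatrix, Matrix.mul_diagonal]
  by_cases h : C.HasArrow α i j
  · simp [h.source]
  · simp [arrowMatrix, h]

theorem vertexMatrix_mul_arrowMatrix (C : Walk V) (α : Quiver.Total V) :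
    C.vertexMatrix k α.right * C.arrowMatrix k α = C.arrowMatrix k α := by
  ext j i
  rw [vertexMatrix, Matrix.diagonal_mul]
  by_cases h : C.HasArrow α i j
  · simp [h.target]
  · simp [arrowMatrix, h]

theorem vertexMatrix_mul_self (C : Walk V) (x : V) :
    C.vertexMatrix k x * C.vertexMatrix k x = C.vertexMatrix k x := by
  rw [vertexMatrix, Matrix.diagonal_mul_diagonal]
  congr 1; ext i; simp

theorem vertexMatrix_mul_of_ne (C : Walk V) {x y : V} (h : x ≠ y) :
    C.vertexMatrix k x * C.vertexMatrix k y = 0 := by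
  rw [vertexMatrix, vertexMatrix, Matrix.diagonal_mul_diagonal, ← Matrix.diagonal_zero]
  congr 1; ext i
  by_cases hx : C.vertex i = x
  · have : C.vertex i ≠ y := fun hy => h (hx.symm.trans hy)
    simp [this]
  · simp [hx]

theorem vertexMatrix_mul_pathMatrix (C : Walk V) {a b : V} (p : Quiver.Path a b) :
    C.vertexMatrix k b * C.pathMatrix k p = C.pathMatrix k p := by
  cases p with
  | nil => exact C.vertexMatrix_mul_self k a
  | cons p α =>
    rw [pathMatrix, ← Matrix.mul_assoc]
    congr 1
    exact C.vertexMatrix_mul_arrowMatrix k ⟨_, _, α⟩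

theorem pathMatrix_comp (C : Walk V) {a b c : V} (q : Quiver.Path a b) (p : Quiver.Path b c) :
    C.pathMatrix k (q.comp p) = C.pathMatrix k p * C.pathMatrix k q := by
  induction p with
  | nil => exact (C.vertexMatrix_mul_pathMatrix k q).symm
  | cons p α ih => rw [Quiver.Path.comp_cons, pathMatrix, pathMatrix, ih, Matrix.mul_assoc]

theorem pathMatrix_mul_vertexMatrix (C : Walk V) {a b : V} (p : Quiver.Path a b) :
    C.pathMatrix k p * C.vertexMatrix k a = C.pathMatrix k p := by
  have := C.pathMatrix_comp k (Quiver.Path.nil : Quiver.Path a a) p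
  rw [Quiver.Path.nil_comp] at this
  exact this.symm

theorem sum_vertexMatrix (C : Walk V) [Fintype V] : ∑ x : V, C.vertexMatrix k x = 1 := by
  classical
  ext i j
  rw [Matrix.sum_apply]
  by_cases h : i = j
  · subst h; simp [vertexMatrix]
  · simp [vertexMatrix, h]

variable {k} in
theorem pathMatrix_ne_zero (C : Walk V) {a b : V} (p : Quiver.Path a b)
    (i j : Fin (C.length + 1)) (h : C.pathMatrix k p j i ≠ 0) :
    (j.val = i.val + (directLetters p).length ∧ directLetters p <+: C.letters.drop i.val) ∨
    (i.val = j.val + (directLetters p).length ∧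
      ((directLetters p).map Letter.inv).reverse <+: C.letters.drop j.val) := by
  induction p generalizing j with
  | nil =>
    left
    by_cases hij : j = i
    · simp [directLetters, hij]
    · simp [pathMatrix, vertexMatrix, hij] at h
  | @cons b c p α ih =>
    rw [pathMatrix, Matrix.mul_apply] at h
    obtain ⟨l, -, hl⟩ := Finset.exists_ne_zero_of_sum_ne_zero h
    have ha : C.HasArrow ⟨_, _, α⟩ l j := by
      by_contra hn
      simp [arrowMatrix, hn] at hl
    have ih := ih l (right_ne_zero_of_mul hl)
    simp only [directLetters, List.length_append, List.length_singleton, List.map_append,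
      List.map_cons, List.map_nil, List.reverse_append, List.reverse_singleton,
      List.singleton_append, Letter.inv]
    rcases List.eq_nil_or_concat (directLetters p) with h0 | ⟨L, y, hL⟩
    · have hli : l.val = i.val := by
        rcases ih with ⟨h1, -⟩ | ⟨h1, -⟩ <;> simp [h0] at h1 <;> omega
      rw [h0]
      rcases ha with ⟨h1, h2⟩ | ⟨h1, h2⟩
      · left
        obtain ⟨hn, h3⟩ := List.getElem?_eq_some_iff.1 h2
        refine ⟨by simp; omega, ?_⟩
        rw [← hli, List.drop_eq_getElem_cons hn, h3]
        simp
      · right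
        obtain ⟨hn, h3⟩ := List.getElem?_eq_some_iff.1 h2
        refine ⟨by simp; omega, ?_⟩
        rw [List.drop_eq_getElem_cons hn, h3]
        simp
    · have hy : y.IsDirect := by
        cases p with
        | nil => simp [directLetters] at hL
        | cons p β =>
          simp only [directLetters, List.concat_eq_append] at hL
          obtain ⟨-, hL⟩ := List.append_inj' hL rfl
          exact ⟨_, (List.singleton_inj.1 hL).symm⟩
      have hlen : (directLetters p).length = L.length + 1 := by simp [hL]
      rcases ih with ⟨h1, h2⟩ | ⟨h1, h2⟩
      · rcases ha with ⟨h3, h4⟩ | ⟨h3, h4⟩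
        · left
          refine ⟨by omega, ?_⟩
          obtain ⟨t, ht⟩ := h2
          have h5 : (C.letters.drop i.val)[(directLetters p).length]? =
              some (Letter.direct ⟨_, _, α⟩) := by
            rw [List.getElem?_drop, ← h1, h4]
          rw [← ht, List.getElem?_append_right le_rfl, Nat.sub_self] at h5
          rcases t with _ | ⟨z, t⟩
          · simp at h5
          · simp at h5
            subst h5
            exact ⟨t, by rw [← ht]; simp⟩
        · exfalso
          obtain ⟨t, ht⟩ := h2
          have h5 : (C.letters.drop i.val)[L.length]? = some (Letter.inverse ⟨_, _, α⟩) := by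
            rw [List.getElem?_drop, ← h4]; congr 1; omega
          rw [← ht, hL] at h5
          obtain ⟨β, rfl⟩ := hy
          simp at h5
      · rcases ha with ⟨h3, h4⟩ | ⟨h3, h4⟩
        · exfalso
          obtain ⟨t, ht⟩ := h2
          have h5 : (C.letters.drop l.val)[0]? = some (Letter.direct ⟨_, _, α⟩) := by
            rw [List.getElem?_drop, ← h4]; rfl
          rw [← ht, hL] at h5
          obtain ⟨β, rfl⟩ := hy
          simp [Letter.inv] at h5
        · right
          refine ⟨by omega, ?_⟩
          obtain ⟨hn, h5⟩ := List.getElem?_eq_some_iff.1 h4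
          rw [List.drop_eq_getElem_cons hn, h5, ← h3]
          exact (List.prefix_cons_inj _).2 h2

variable {k} in
theorem pathMatrix_eq_zero (C : Walk V) {a b : V} (p : Quiver.Path a b)
    (h : ¬ directLetters p <:+: C.letters) (h' : ¬ directLetters p <:+: C.inv.letters) :
    C.pathMatrix k p = 0 := by
  ext j i
  by_contra hne
  rcases C.pathMatrix_ne_zero p i j hne with ⟨-, h1⟩ | ⟨-, h1⟩
  · exact h (h1.isInfix.trans (List.drop_suffix _ _).isInfix)
  · apply h'
    have h2 := h1.isInfix.trans (List.drop_suffix _ _).isInfix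
    have h3 := List.reverse_infix.2 (h2.map Letter.inv)
    have h4 : (((directLetters p).map Letter.inv).reverse.map Letter.inv).reverse =
        directLetters p := by
      simp [List.map_reverse, Function.comp_def]
    rw [h4] at h3
    exact h3

variable [Fintype V]

/-- The representation of the path algebra given by the diagram of a walk. -/
noncomputable def rep (C : Walk V) :
    PathAlgebra k V →ₐ[k] Matrix (Fin (C.length + 1)) (Fin (C.length + 1)) k :=
  AlgHom.ofLinearMap (lin k fun p => C.pathMatrix k p.path)
    (by simp [one_def, pathMatrix, sum_vertexMatrix])
    (by
      intro x y
      have key : (mulLin k V).compr₂ (lin k fun p => C.pathMatrix k p.path) =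
          (LinearMap.mul k (Matrix (Fin (C.length + 1)) (Fin (C.length + 1)) k)).compl₁₂ (lin k fun p => C.pathMatrix k p.path)
            (lin k fun p => C.pathMatrix k p.path) := by
        refine hom_ext fun p => hom_ext fun q => ?_
        obtain ⟨b, c, p⟩ := p
        obtain ⟨a, b', q⟩ := q
        change lin k (fun p : QPath V => C.pathMatrix k p.path)
            (ofPath k ⟨b, c, p⟩ * ofPath k ⟨a, b', q⟩) =
          lin k (fun p : QPath V => C.pathMatrix k p.path) (ofPath k ⟨b, c, p⟩) *
            lin k (fun p : QPath V => C.pathMatrix k p.path) (ofPath k ⟨a, b', q⟩)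
        rw [ofPath_mul]
        by_cases h : b = b'
        · subst h
          simp [pathMul_comp, pathMatrix_comp]
        · rw [pathMul_of_ne h, lin_ofPath, lin_ofPath, map_zero,
            ← C.pathMatrix_mul_vertexMatrix k p, ← C.vertexMatrix_mul_pathMatrix k q,
            Matrix.mul_assoc, ← Matrix.mul_assoc (C.vertexMatrix k b),
            C.vertexMatrix_mul_of_ne k h]
          simp
      exact LinearMap.congr_fun (LinearMap.congr_fun key x) y)

@[simp] theorem rep_ofPath (C : Walk V) (p : QPath V) :
    C.rep k (ofPath k p) = C.pathMatrix k p.path :=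
  lin_ofPath _ p


end Walk

variable {k} [Fintype V] {I : TwoSidedIdeal (PathAlgebra k V)}

theorem Str.rep_eq_zero [IsAdmissibleMonomial I] (C : Str I) (x : PathAlgebra k V)
    (hx : x ∈ I.asIdeal) : C.walk.rep k x = 0 := by
  obtain ⟨S, hS, hI⟩ := IsAdmissibleMonomial.generated (I := I)
  have hle : I ≤ TwoSidedIdeal.ker (C.walk.rep k) := by
    conv_lhs => rw [hI]
    rw [TwoSidedIdeal.span_le]
    rintro _ ⟨p, hp, rfl⟩
    have hpI : ofPath k p ∈ I := by
      rw [hI]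
      exact TwoSidedIdeal.subset_span ⟨p, hp, rfl⟩
    obtain ⟨h1, h2⟩ := C.2.avoids p (le_trans one_le_two (hS p hp)) hpI
    rw [SetLike.mem_coe, TwoSidedIdeal.mem_ker, Walk.rep_ofPath]
    exact C.walk.pathMatrix_eq_zero p.path h1 h2
  exact TwoSidedIdeal.mem_ker _ |>.1 (hle (TwoSidedIdeal.mem_asIdeal.1 hx))

/-- The algebra `kQ/I` acts through the diagram of a string. -/
noncomputable def Str.quotientRep [IsAdmissibleMonomial I] (C : Str I) :
    BoundAlgebra I →+* Matrix (Fin (C.length + 1)) (Fin (C.length + 1)) k :=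
  Ideal.Quotient.lift I.asIdeal (C.walk.rep k).toRingHom C.rep_eq_zero

/-- The string module `M(C)`: it has one basis vector for each position of the diagram of `C`. -/
def StringModule (C : Str I) : Type w := Fin (C.length + 1) → k

namespace StringModule

noncomputable instance (C : Str I) : AddCommGroup (StringModule C) :=
  inferInstanceAs (AddCommGroup (Fin (C.length + 1) → k))

noncomputable instance (C : Str I) : Module k (StringModule C) :=
  inferInstanceAs (Module k (Fin (C.length + 1) → k))

/-- Left `kQ/I`-module structure: an element acts by its matrix. -/
noncomputable instance [IsAdmissibleMonomial I] (C : Str I) :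
    Module (BoundAlgebra I) (StringModule C) :=
  Module.compHom (R := Module.End k (StringModule C)) (StringModule C)
    ((Matrix.toLinAlgEquiv' (R := k) (n := Fin (C.length + 1))).toAlgHom.toRingHom.comp
      C.quotientRep)

theorem mk_ofPath_smul [IsAdmissibleMonomial I] (C : Str I) (p : QPath V)
    (m : Fin (C.length + 1) → k) :
    (Ideal.Quotient.mk I.asIdeal (ofPath k p) : BoundAlgebra I) • (show StringModule C from m) =
      (C.walk.pathMatrix k p.path).mulVec m := by
  change (C.walk.rep k (ofPath k p)).mulVec m = _
  rw [Walk.rep_ofPath]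

end StringModule

end

/-- `Y` lies in `Fac X`: it is a finitely generated module which is a quotient of a finite direct
sum of copies of `X`. -/
def InFac (A : Type*) [Ring A] (X Y : Type*) [AddCommGroup X] [Module A X] [AddCommGroup Y]
    [Module A Y] : Prop :=
  Module.Finite A Y ∧ ∃ (n : ℕ) (f : (Fin n → X) →ₗ[A] Y), Function.Surjective f

section

variable {k : Type w} {V : Type u} [Field k] [Quiver.{v} V] [Fintype V]

/-- `Y` is the union of the middle strings `E` of the factorizations `Y = F E D` in `𝒮`, where a
triple is listed as `(F, E, D)`: every position and every arrow of the diagram of `Y` occurs in one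
of these substrings. -/
def IsUnion {I : TwoSidedIdeal (PathAlgebra k V)} (Y : Str I)
    (𝒮 : Set (Str I × Str I × Str I)) : Prop :=
  (∀ i : ℕ, i ≤ Y.length → ∃ T ∈ 𝒮, T.2.2.length ≤ i ∧ i ≤ T.2.2.length + T.2.1.length) ∧
  (∀ i : ℕ, i < Y.length → ∃ T ∈ 𝒮, T.2.2.length ≤ i ∧ i < T.2.2.length + T.2.1.length)

end

end GentleStrings

/-! A walk that never follows a letter by its inverse carries at most one arrow with a given label
out of each position and at most one into it, so every arrow acts on the basis vectors of a string
module as a partial injection. Consequently a partial bijection between positions that respects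
vertices and arrows is a homomorphism (`exists_hom_of_isSupport`). This yields the inclusion of a
submodule substring, the projection onto a factor and the map M(E) → M(E⁻¹). If a position q of Y
lies in a submodule substring E that is a factor of some X_i, the composite M(X_i) → M(E) → M(Y)
reaches the basis vector at q; adding such maps over all q gives a surjection.

Conversely, a surjection onto M(Y) has, for each position q of Y, a component φ : M(X_i) → M(Y) and
a position p for which φ(b_p) has a nonzero coefficient at q. No description of the Hom space is
needed, only the support of φ, the set of all such pairs. Along it, arrows into p lift to arrows
into q, and arrows out of q descend to arrows out of p (`isSupport`). Starting from (p, q), these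
two rules force letters of X_i and Y to agree. The common substring obtained by following forced
letters both ways stops where nothing more is forced, which says exactly that it is a quotient
substring of X_i and a submodule substring of Y (`IsSupport.exists_common`).

One obstruction remains: a forced arrow on one side of p may be matched on the other side of q.
Reducedness forbids matches in both orientations at one pair, so reading X_i backwards removes the
obstruction (`Str.exists_factor`). Finally, a submodule substring is closed under arrows starting in
it, so covering all positions covers all arrows (`Str.isUnion_of_forall_position`). -/

namespace GentleStrings

open Quiver PathAlgebra

universe u v w

/-! ### Arrows in lists of letters, and reading a list backwards -/

section

variable {V : Type u} [Quiver.{v} V]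

/-- In a list of letters, regarded as a diagram, there is an arrow labelled `α` from position `i`
to position `j`. -/
def ArrowAt (L : List (Letter V)) (α : Quiver.Total V) (i j : ℕ) : Prop :=
  (j = i + 1 ∧ L[i]? = some (Letter.direct α)) ∨ (i = j + 1 ∧ L[j]? = some (Letter.inverse α))

/-- No letter of the list is followed by its inverse. -/
abbrev Reduced (L : List (Letter V)) : Prop := L.IsChain (fun x y => y ≠ x.inv)

theorem Reduced.ne_inv {L : List (Letter V)} (h : Reduced L) {i : ℕ} {x y : Letter V}
    (hx : L[i]? = some x) (hy : L[i + 1]? = some y) : y ≠ x.inv := by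
  obtain ⟨hi, rfl⟩ := List.getElem?_eq_some_iff.1 hx
  obtain ⟨hj, rfl⟩ := List.getElem?_eq_some_iff.1 hy
  exact List.isChain_iff_getElem.1 h i hj

theorem ArrowAt.le_length {L : List (Letter V)} {α : Quiver.Total V} {i j : ℕ}
    (h : ArrowAt L α i j) : i ≤ L.length ∧ j ≤ L.length := by
  rcases h with ⟨h1, h2⟩ | ⟨h1, h2⟩ <;> obtain ⟨h3, -⟩ := List.getElem?_eq_some_iff.1 h2 <;>
    constructor <;> omega

/-- Two different targets would lie on the two sides of `i`, making the letters around `i` the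
inverse of `α` followed by `α`. With `source_unique`, this is what makes arrows act as partial
injections on positions. -/
theorem ArrowAt.target_unique {L : List (Letter V)} (hL : Reduced L) {α : Quiver.Total V}
    {i j j' : ℕ} (h : ArrowAt L α i j) (h' : ArrowAt L α i j') : j = j' := by
  rcases h with ⟨rfl, h2⟩ | ⟨rfl, h2⟩ <;> rcases h' with ⟨h3, h4⟩ | ⟨h3, h4⟩
  · omega
  · subst h3; exact absurd rfl (hL.ne_inv h4 h2)
  · exact absurd rfl (hL.ne_inv h2 h4)
  · omega

theorem ArrowAt.source_unique {L : List (Letter V)} (hL : Reduced L) {α : Quiver.Total V}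
    {i i' j : ℕ} (h : ArrowAt L α i j) (h' : ArrowAt L α i' j) : i = i' := by
  rcases h with ⟨rfl, h2⟩ | ⟨rfl, h2⟩ <;> rcases h' with ⟨h3, h4⟩ | ⟨h3, h4⟩
  · omega
  · exact absurd rfl (hL.ne_inv h2 h4)
  · subst h3; exact absurd rfl (hL.ne_inv h4 h2)
  · omega

/-- The letters of the inverse walk. -/
def invLetters (L : List (Letter V)) : List (Letter V) := (L.map Letter.inv).reverse

@[simp] theorem length_invLetters (L : List (Letter V)) : (invLetters L).length = L.length := by
  simp [invLetters]

theorem invLetters_invLetters (L : List (Letter V)) : invLetters (invLetters L) = L := by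
  simp [invLetters, List.map_reverse, Function.comp_def]

theorem invLetters_append (L L' : List (Letter V)) :
    invLetters (L ++ L') = invLetters L' ++ invLetters L := by
  simp [invLetters]

theorem getElem?_invLetters {L : List (Letter V)} {i j : ℕ} (h : i + j + 1 = L.length) :
    (invLetters L)[i]? = L[j]?.map Letter.inv := by
  rw [invLetters, List.getElem?_reverse (by simp; omega), List.getElem?_map, List.length_map]
  congr 2
  omega

theorem getElem?_invLetters_eq_some {L : List (Letter V)} {i j : ℕ} (h : i + j + 1 = L.length)
    {x : Letter V} : (invLetters L)[i]? = some x ↔ L[j]? = some x.inv := by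
  rw [getElem?_invLetters h, Option.map_eq_some_iff]
  constructor
  · rintro ⟨y, hy, rfl⟩; simpa using hy
  · intro h; exact ⟨_, h, by simp⟩

theorem reduced_invLetters {L : List (Letter V)} (h : Reduced L) : Reduced (invLetters L) := by
  rw [Reduced, invLetters, List.isChain_reverse, List.isChain_map]
  refine h.imp fun x y hxy e => hxy ?_
  rw [Letter.inv_inv] at e
  exact e.symm

theorem ArrowAt.invLetters {L : List (Letter V)} {α : Quiver.Total V} {i j i' j' : ℕ}
    (h : ArrowAt L α i j) (hi : i + i' = L.length) (hj : j + j' = L.length) :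
    ArrowAt (invLetters L) α i' j' := by
  rcases h with ⟨rfl, h⟩ | ⟨rfl, h⟩
  · exact Or.inr ⟨by omega, (getElem?_invLetters_eq_some (j := i) (by omega)).2 h⟩
  · exact Or.inl ⟨by omega, (getElem?_invLetters_eq_some (j := j) (by omega)).2 h⟩

theorem arrowAt_invLetters {L : List (Letter V)} {α : Quiver.Total V} {i j i' j' : ℕ}
    (hi : i + i' = L.length) (hj : j + j' = L.length) :
    ArrowAt (invLetters L) α i' j' ↔ ArrowAt L α i j := by
  refine ⟨fun h => ?_, fun h => h.invLetters hi hj⟩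
  have := h.invLetters (i' := i) (j' := j) (by simp; omega) (by simp; omega)
  rwa [invLetters_invLetters] at this

/-! ### Common substrings -/

/-- The properties of the support `N` of a homomorphism from the string module with letters `L` to
the string module with letters `M`: arrows into a position lift along `N`, and arrows out of a
position descend. -/
structure IsSupport (L M : List (Letter V)) (N : ℕ → ℕ → Prop) : Prop where
  le : ∀ {p q}, N p q → p ≤ L.length ∧ q ≤ M.length
  lift : ∀ {p q p' α}, N p q → ArrowAt L α p' p → ∃ q', ArrowAt M α q' q ∧ N p' q'
  descend : ∀ {p q q' α}, N p q → ArrowAt M α q q' → ∃ p', ArrowAt L α p p' ∧ N p' q'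

/-- The conditions mention only arrows of the diagram of `L`, not the direction in which it is read,
so they survive renumbering its positions from the other end. -/
theorem IsSupport.invLetters {L M : List (Letter V)} {N : ℕ → ℕ → Prop} (h : IsSupport L M N) :
    IsSupport (invLetters L) M fun p q => ∃ p', p + p' = L.length ∧ N p' q where
  le := by
    rintro p q ⟨p', h1, h2⟩
    exact ⟨by simp; omega, (h.le h2).2⟩
  lift := by
    rintro p q p₁ α ⟨p', h1, h2⟩ h3
    have h4 := h3.le_length.1
    rw [length_invLetters] at h4
    rw [arrowAt_invLetters (i := L.length - p₁) (j := p') (by omega) (by omega)] at h3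
    obtain ⟨q', h5, h6⟩ := h.lift h2 h3
    exact ⟨q', h5, _, by omega, h6⟩
  descend := by
    rintro p q q' α ⟨p', h1, h2⟩ h3
    obtain ⟨p₁, h5, h6⟩ := h.descend h2 h3
    have := (h.le h6).1
    exact ⟨L.length - p₁, h5.invLetters (by omega) (by omega), p₁, by omega, h6⟩

/-- Around the positions `p` and `q`, two letters occur in opposite directions. -/
def MatchOpposite (L M : List (Letter V)) (p q : ℕ) : Prop :=
  ∃ x : Letter V, (L[p]? = some x ∧ ∃ q', q = q' + 1 ∧ M[q']? = some x.inv) ∨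
    ((∃ p', p = p' + 1 ∧ L[p']? = some x) ∧ M[q]? = some x.inv)

/-- Around the positions `p` and `q`, two letters occur in the same direction. -/
def MatchSame (L M : List (Letter V)) (p q : ℕ) : Prop :=
  ∃ x : Letter V, (L[p]? = some x ∧ M[q]? = some x) ∨
    (∃ p', p = p' + 1 ∧ L[p']? = some x) ∧ ∃ q', q = q' + 1 ∧ M[q']? = some x

/-- In each of the four combinations both matches involve the same letter of one list, hence the
same `x` up to inversion, and the other list then has two adjacent letters that are inverse to each
other. -/
theorem not_matchSame_of_matchOpposite {L M : List (Letter V)} (hL : Reduced L) (hM : Reduced M)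
    {p q : ℕ} (h : MatchOpposite L M p q) : ¬ MatchSame L M p q := by
  rintro ⟨y, ⟨h1, h2⟩ | ⟨⟨p', rfl, h1⟩, q', rfl, h2⟩⟩ <;>
    obtain ⟨x, ⟨h3, q₁, h4, h5⟩ | ⟨⟨p₁, h4, h3⟩, h5⟩⟩ := h
  · subst h4
    obtain rfl : y = x := by simpa [h3] using h1.symm
    exact hM.ne_inv h5 h2 (by simp)
  · subst h4
    obtain rfl : x.inv = y := by simpa [h5] using h2
    exact hL.ne_inv h3 h1 rfl
  · obtain rfl : q' = q₁ := by omega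
    obtain rfl : x.inv = y := by simpa [h5] using h2
    exact hL.ne_inv h1 h3 (by simp)
  · obtain rfl : p' = p₁ := by omega
    obtain rfl : y = x := by simpa [h3] using h1.symm
    exact hM.ne_inv h2 h5 rfl

/-- Reversing `L` exchanges the two sides of the position and inverts the letters there, which turns
one orientation of a match into the other. -/
theorem matchSame_of_matchOpposite_invLetters {L M : List (Letter V)} {p q p' : ℕ}
    (hp : p + p' = L.length) (h : MatchOpposite (invLetters L) M p q) : MatchSame L M p' q := by
  obtain ⟨x, ⟨h3, q₁, h4, h5⟩ | ⟨⟨p₁, h4, h3⟩, h5⟩⟩ := h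
  · have h6 := (List.getElem?_eq_some_iff.1 h3).1
    rw [length_invLetters] at h6
    refine ⟨x.inv, Or.inr ⟨⟨p' - 1, by omega, ?_⟩, q₁, h4, h5⟩⟩
    exact (getElem?_invLetters_eq_some (by omega)).1 h3
  · exact ⟨x.inv, Or.inl ⟨(getElem?_invLetters_eq_some (by omega)).1 h3, h5⟩⟩

/-- To the right of `p` and `q`, the letters that a homomorphism has to respect are matched. -/
structure RightCompatible (L M : List (Letter V)) (N : ℕ → ℕ → Prop) (p q : ℕ) : Prop where
  inverse : ∀ α, L[p]? = some (Letter.inverse α) →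
    M[q]? = some (Letter.inverse α) ∧ N (p + 1) (q + 1)
  direct : ∀ α, M[q]? = some (Letter.direct α) →
    L[p]? = some (Letter.direct α) ∧ N (p + 1) (q + 1)

/-- To the left of `p` and `q`, the letters that a homomorphism has to respect are matched. -/
structure LeftCompatible (L M : List (Letter V)) (N : ℕ → ℕ → Prop) (p q : ℕ) : Prop where
  direct : ∀ α p', p = p' + 1 → L[p']? = some (Letter.direct α) →
    ∃ q', q = q' + 1 ∧ M[q']? = some (Letter.direct α) ∧ N p' q'
  inverse : ∀ α q', q = q' + 1 → M[q']? = some (Letter.inverse α) →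
    ∃ p', p = p' + 1 ∧ L[p']? = some (Letter.inverse α) ∧ N p' q'

variable {L M : List (Letter V)} {N : ℕ → ℕ → Prop}

/-- An arrow produced by `lift` or `descend` lies either on the same side as the given one, as
wanted, or on the other side, which is an opposite match. -/
theorem IsSupport.rightCompatible {p q : ℕ} (h : IsSupport L M N) (hN : N p q)
    (ho : ¬ MatchOpposite L M p q) : RightCompatible L M N p q where
  inverse := by
    intro α h1
    obtain ⟨q', ⟨rfl, h3⟩ | ⟨rfl, h3⟩, h4⟩ := h.lift hN (p' := p + 1) (Or.inr ⟨rfl, h1⟩)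
    · exact absurd ⟨_, Or.inl ⟨h1, q', rfl, h3⟩⟩ ho
    · exact ⟨h3, h4⟩
  direct := by
    intro α h1
    obtain ⟨p', ⟨rfl, h3⟩ | ⟨rfl, h3⟩, h4⟩ := h.descend hN (q' := q + 1) (Or.inl ⟨rfl, h1⟩)
    · exact ⟨h3, h4⟩
    · exact absurd ⟨_, Or.inr ⟨⟨p', rfl, h3⟩, h1⟩⟩ ho

theorem IsSupport.leftCompatible {p q : ℕ} (h : IsSupport L M N) (hN : N p q)
    (ho : ¬ MatchOpposite L M p q) : LeftCompatible L M N p q where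
  direct := by
    rintro α p' rfl h1
    obtain ⟨q', ⟨rfl, h3⟩ | ⟨rfl, h3⟩, h4⟩ := h.lift hN (p' := p') (Or.inl ⟨rfl, h1⟩)
    · exact ⟨q', rfl, h3, h4⟩
    · exact absurd ⟨_, Or.inr ⟨⟨p', rfl, h1⟩, h3⟩⟩ ho
  inverse := by
    rintro α q' rfl h1
    obtain ⟨p', ⟨rfl, h3⟩ | ⟨rfl, h3⟩, h4⟩ := h.descend hN (q' := q') (Or.inr ⟨rfl, h1⟩)
    · exact absurd ⟨_, Or.inl ⟨h3, q', rfl, h1⟩⟩ ho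
    · exact ⟨p', rfl, h3, h4⟩

theorem not_matchOpposite_of_matchSame {p q : ℕ} (hL : Reduced L) (hM : Reduced M)
    (h : MatchSame L M p q) : ¬ MatchOpposite L M p q :=
  fun h' => not_matchSame_of_matchOpposite hL hM h' h

/-- Move right as long as a letter is forced. The letter just crossed is the same in both lists, so
the new pair of positions has no opposite match and compatibility renews itself. Nothing is forced
any more exactly when `L` continues with a direct letter or ends, and `M` continues with an inverse
letter or ends. Each move shortens the rest of `L`. -/
theorem IsSupport.exists_right {p q : ℕ} (hL : Reduced L) (hM : Reduced M)
    (h : IsSupport L M N) (hN : N p q) (hc : RightCompatible L M N p q) :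
    ∃ m, N (p + m) (q + m) ∧ (∀ i < m, L[p + i]? = M[q + i]?) ∧
      (∀ x, L[p + m]? = some x → x.IsDirect) ∧ ∀ x, M[q + m]? = some x → x.IsInverse := by
  -- The continuation is the same whether the letter was forced by `L` or by `M`.
  have step : ∀ x, L[p]? = some x → M[q]? = some x → N (p + 1) (q + 1) →
      ∃ m, N (p + m) (q + m) ∧ (∀ i < m, L[p + i]? = M[q + i]?) ∧
      (∀ x, L[p + m]? = some x → x.IsDirect) ∧ ∀ x, M[q + m]? = some x → x.IsInverse := by
    intro x h1 h2 h3
    have hlt := (List.getElem?_eq_some_iff.1 h1).1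
    have ho : ¬ MatchOpposite L M (p + 1) (q + 1) :=
      not_matchOpposite_of_matchSame hL hM
        ⟨x, Or.inr ⟨⟨p, rfl, h1⟩, q, rfl, h2⟩⟩
    obtain ⟨m, h4, h5, h6, h7⟩ := IsSupport.exists_right hL hM h h3 (h.rightCompatible h3 ho)
    have e1 : p + 1 + m = p + (m + 1) := by omega
    have e2 : q + 1 + m = q + (m + 1) := by omega
    rw [e1] at h4 h6
    rw [e2] at h4 h7
    refine ⟨m + 1, h4, ?_, h6, h7⟩
    rintro (_ | i) hi
    · simp [h1, h2]
    · have := h5 i (by omega)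
      rwa [show p + 1 + i = p + (i + 1) by omega, show q + 1 + i = q + (i + 1) by omega] at this
  by_cases hx : ∃ α, L[p]? = some (Letter.inverse α)
  · obtain ⟨α, hα⟩ := hx
    exact step _ hα (hc.inverse α hα).1 (hc.inverse α hα).2
  by_cases hy : ∃ α, M[q]? = some (Letter.direct α)
  · obtain ⟨α, hα⟩ := hy
    exact step _ (hc.direct α hα).1 hα (hc.direct α hα).2
  refine ⟨0, hN, by simp, ?_, ?_⟩
  · rintro (α | α) h1
    · exact ⟨α, rfl⟩
    · exact absurd ⟨α, h1⟩ hx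
  · rintro (α | α) h1
    · exact absurd ⟨α, h1⟩ hy
    · exact ⟨α, rfl⟩
termination_by L.length - p

/-- Mirror image of `IsSupport.exists_right`: arrows into `p` are now direct letters and arrows out
of `q` inverse ones, and `p` itself decreases. -/
theorem IsSupport.exists_left {p q : ℕ} (hL : Reduced L) (hM : Reduced M)
    (h : IsSupport L M N) (hN : N p q) (hc : LeftCompatible L M N p q) :
    ∃ d e m, d + m = p ∧ e + m = q ∧ N d e ∧ (∀ i < m, L[d + i]? = M[e + i]?) ∧
      (∀ d' x, d = d' + 1 → L[d']? = some x → x.IsInverse) ∧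
      ∀ e' x, e = e' + 1 → M[e']? = some x → x.IsDirect := by
  have step : ∀ x p' q', p = p' + 1 → q = q' + 1 → L[p']? = some x → M[q']? = some x → N p' q' →
      ∃ d e m, d + m = p ∧ e + m = q ∧ N d e ∧ (∀ i < m, L[d + i]? = M[e + i]?) ∧
      (∀ d' x, d = d' + 1 → L[d']? = some x → x.IsInverse) ∧
      ∀ e' x, e = e' + 1 → M[e']? = some x → x.IsDirect := by
    intro x p' q' hp hq h1 h2 h3
    have ho : ¬ MatchOpposite L M p' q' :=
      not_matchOpposite_of_matchSame hL hM ⟨x, Or.inl ⟨h1, h2⟩⟩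
    obtain ⟨d, e, m, hd, he, h4, h5, h6, h7⟩ :=
      IsSupport.exists_left hL hM h h3 (h.leftCompatible h3 ho)
    refine ⟨d, e, m + 1, by omega, by omega, h4, ?_, h6, h7⟩
    intro i hi
    rcases Nat.lt_succ_iff_lt_or_eq.1 hi with hi | rfl
    · exact h5 i hi
    · rw [hd, he, h1, h2]
  by_cases hx : ∃ α p', p = p' + 1 ∧ L[p']? = some (Letter.direct α)
  · obtain ⟨α, p', hp, hα⟩ := hx
    obtain ⟨q', hq, h1, h2⟩ := hc.direct α p' hp hα
    exact step _ _ _ hp hq hα h1 h2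
  by_cases hy : ∃ α q', q = q' + 1 ∧ M[q']? = some (Letter.inverse α)
  · obtain ⟨α, q', hq, hα⟩ := hy
    obtain ⟨p', hp, h1, h2⟩ := hc.inverse α q' hq hα
    exact step _ _ _ hp hq h1 hα h2
  refine ⟨p, q, 0, rfl, rfl, hN, by simp, ?_, ?_⟩
  · rintro d' (α | α) rfl h1
    · exact absurd ⟨α, d', rfl, h1⟩ hx
    · exact ⟨α, rfl⟩
  · rintro e' (α | α) rfl h1
    · exact ⟨α, rfl⟩
    · exact absurd ⟨α, e', rfl, h1⟩ hy
termination_by p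

/-- Two positions related by the support of a homomorphism, with no letters around them in
opposite directions, lie in a common substring which is a quotient on the left and a submodule on
the right. -/
theorem IsSupport.exists_common {p q : ℕ} (hL : Reduced L) (hM : Reduced M)
    (h : IsSupport L M N) (hN : N p q) (ho : ¬ MatchOpposite L M p q) :
    ∃ d e m, e ≤ q ∧ q ≤ e + m ∧ d + m ≤ L.length ∧ e + m ≤ M.length ∧ N d e ∧
      (∀ i < m, L[d + i]? = M[e + i]?) ∧
      (∀ x, L[d + m]? = some x → x.IsDirect) ∧ (∀ x, M[e + m]? = some x → x.IsInverse) ∧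
      (∀ d' x, d = d' + 1 → L[d']? = some x → x.IsInverse) ∧
      ∀ e' x, e = e' + 1 → M[e']? = some x → x.IsDirect := by
  obtain ⟨m, h1, h2, h3, h4⟩ := h.exists_right hL hM hN (h.rightCompatible hN ho)
  obtain ⟨d, e, n, hd, he, h5, h6, h7, h8⟩ := h.exists_left hL hM hN (h.leftCompatible hN ho)
  have := h.le h1
  subst hd he
  refine ⟨d, e, n + m, by omega, by omega, by omega, by omega, h5, ?_, ?_, ?_, h7, h8⟩
  · intro i hi
    by_cases hin : i < n
    · exact h6 i hin
    · have := h2 (i - n) (by omega)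
      rwa [show d + n + (i - n) = d + i by omega, show e + n + (i - n) = e + i by omega] at this
  · rwa [← add_assoc]
  · rwa [← add_assoc]

end

/-! ### Substrings -/

section

variable {V : Type u} [Quiver.{v} V]

namespace Walk

/-- The part of the walk of length `m` that starts at the position `a`. -/
def sub (C : Walk V) (a m : ℕ) (h : a + m ≤ C.length) : Walk V where
  start := C.vertex ⟨a, by omega⟩
  letters := (C.letters.drop a).take m
  composable := (C.composable.drop a).take m
  start_eq := by
    intro x hx
    rw [List.head?_eq_getElem?, List.getElem?_take, Option.mem_def] at hx
    split_ifs at hx with h0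
    rw [List.getElem?_drop] at hx
    exact (C.vertex_of_letter hx _ rfl).symm

@[simp] theorem length_sub (C : Walk V) (a m : ℕ) (h : a + m ≤ C.length) :
    (C.sub a m h).length = m := by
  simp only [length] at h
  simp [length, sub]
  omega

theorem getElem?_letters_sub (C : Walk V) {a m i : ℕ} (h : a + m ≤ C.length) (hi : i < m) :
    (C.sub a m h).letters[i]? = C.letters[a + i]? := by
  simp [sub, hi]

theorem vertex_sub (C : Walk V) {a m : ℕ} (h : a + m ≤ C.length)
    (i : Fin ((C.sub a m h).length + 1)) (j : Fin (C.length + 1)) (hj : j.val = a + i.val) :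
    (C.sub a m h).vertex i = C.vertex j := by
  obtain ⟨i, hi⟩ := i
  obtain ⟨j, hj'⟩ := j
  obtain rfl : j = a + i := hj
  rcases i with _ | i
  · rfl
  · have h1 : i < m := by rw [length_sub] at hi; omega
    have h2 : a + i < C.letters.length := by rw [length] at h; omega
    have h3 : C.letters[a + i]? = some C.letters[a + i] := List.getElem?_eq_getElem h2
    rw [(C.sub a m h).vertex_succ ((C.getElem?_letters_sub h h1).trans h3) _ rfl,
      C.vertex_succ h3 _ rfl]

theorem finish_sub (C : Walk V) {a m : ℕ} (h : a + m ≤ C.length) :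
    (C.sub a m h).finish = C.vertex ⟨a + m, by omega⟩ :=
  C.vertex_sub h _ _ (by simp)

theorem finish_eq_start (C : Walk V) (h : C.length = 0) : C.finish = C.start :=
  congrArg C.vertex (Fin.ext h : Fin.last C.length = 0)

theorem finish_eq_tgt (C : Walk V) {n : ℕ} {x : Letter V} (h : C.letters[n]? = some x)
    (hn : C.length = n + 1) : C.finish = x.tgt :=
  C.vertex_succ h _ hn

theorem finish_inv (C : Walk V) : C.inv.finish = C.start := by
  obtain ⟨s, l, hc, hs⟩ := C
  rcases l with _ | ⟨x, l⟩
  · rfl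
  · have hx : x.inv ∈ (Walk.inv ⟨s, x :: l, hc, hs⟩).letters.getLast? := by simp [inv]
    rw [← Walk.finish_eq_of_getLast? _ hx, Letter.tgt_inv]
    exact hs x (by simp)

theorem letters_inv (C : Walk V) : C.inv.letters = invLetters C.letters := rfl

@[simp] theorem length_inv (C : Walk V) : C.inv.length = C.length := by simp [length, letters_inv]

@[simp] theorem inv_inv (C : Walk V) : C.inv.inv = C :=
  Walk.ext C.finish_inv (invLetters_invLetters _)

theorem vertex_inv (C : Walk V) (i : Fin (C.inv.length + 1)) (j : Fin (C.length + 1))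
    (hij : i.val + j.val = C.length) : C.inv.vertex i = C.vertex j := by
  obtain ⟨i, hi⟩ := i
  obtain ⟨j, hj⟩ := j
  simp only at hij
  rcases i with _ | i
  · obtain rfl : j = C.length := by omega
    rfl
  · have hj' : j < C.letters.length := by rw [length] at hij; omega
    have h := List.getElem?_eq_getElem hj'
    have h' : C.inv.letters[i]? = some C.letters[j].inv := by
      rw [letters_inv, getElem?_invLetters_eq_some (j := j) (by rw [length] at hij; omega),
        Letter.inv_inv, h]
    rw [C.inv.vertex_succ h' _ rfl, C.vertex_of_letter h _ rfl, Letter.tgt_inv]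

end Walk

variable {k : Type w} [Field k] [Fintype V] {I : TwoSidedIdeal (PathAlgebra k V)}

theorem IsString.inv {C : Walk V} (h : IsString I C) : IsString I C.inv where
  reduced := reduced_invLetters h.reduced
  avoids p hp hI := by
    rw [Walk.inv_inv]
    exact (h.avoids p hp hI).symm

theorem IsString.of_infix {C E : Walk V} (h : IsString I C) (hE : E.letters <:+: C.letters) :
    IsString I E where
  reduced := h.reduced.infix hE
  avoids p hp hI := by
    obtain ⟨h1, h2⟩ := h.avoids p hp hI
    exact ⟨fun h' => h1 (h'.trans hE),
      fun h' => h2 (h'.trans (List.reverse_infix.2 (hE.map Letter.inv)))⟩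

namespace Str

/-- The inverse string. -/
def inv (C : Str I) : Str I := ⟨C.walk.inv, C.2.inv⟩

/-- The substring of length `m` that starts at the position `a`. -/
def sub (C : Str I) (a m : ℕ) (h : a + m ≤ C.length) : Str I :=
  ⟨C.walk.sub a m h, C.2.of_infix ((List.take_prefix _ _).isInfix.trans
    (List.drop_suffix _ _).isInfix)⟩

@[simp] theorem length_sub (C : Str I) (a m : ℕ) (h : a + m ≤ C.length) :
    (C.sub a m h).length = m := C.walk.length_sub a m h

theorem isFactorization_sub (C : Str I) {a m n : ℕ} (h : a + m + n = C.length) :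
    IsFactorization C (C.sub (a + m) n h.le) (C.sub a m (by omega)) (C.sub 0 a (by omega)) where
  start_left := rfl
  start_mid := by
    refine Eq.trans ?_ (C.walk.finish_sub (a := 0) (m := a) (by change _ ≤ C.length; omega)).symm
    exact congrArg C.walk.vertex (Fin.ext (zero_add a).symm)
  start_right := (C.walk.finish_sub (a := a) (m := m) (by change _ ≤ C.length; omega)).symm
  letters_eq := by
    have h1 : C.walk.letters.length = a + m + n := h.symm
    change _ = (C.walk.letters.drop 0).take a ++ (C.walk.letters.drop a).take m ++
      (C.walk.letters.drop (a + m)).take n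
    rw [List.drop_zero, List.take_of_length_le (i := n) (by simp; omega), List.append_assoc,
      ← List.drop_drop, List.take_append_drop, List.take_append_drop]

/-! ### Factorizations of strings and their inverses -/

variable {C F E D : Str I}

theorem IsFactorization.length_eq (h : IsFactorization C F E D) :
    D.length + E.length + F.length = C.length := by
  have := congrArg List.length h.letters_eq
  simpa [length, Walk.length, add_assoc] using this.symm

theorem IsFactorization.getElem?_left (h : IsFactorization C F E D) {i : ℕ} (hi : i < D.length) :
    C.walk.letters[i]? = D.walk.letters[i]? := by
  rw [h.letters_eq, List.append_assoc, List.getElem?_append_left hi]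

theorem IsFactorization.getElem?_mid (h : IsFactorization C F E D) {i : ℕ} (hi : i < E.length) :
    C.walk.letters[D.length + i]? = E.walk.letters[i]? := by
  rw [h.letters_eq, List.append_assoc,
    List.getElem?_append_right (by simp [length, Walk.length])]
  simp only [length, Walk.length, Nat.add_sub_cancel_left]
  exact List.getElem?_append_left hi

theorem IsFactorization.getElem?_right (h : IsFactorization C F E D) (i : ℕ) :
    C.walk.letters[D.length + E.length + i]? = F.walk.letters[i]? := by
  rw [h.letters_eq, List.getElem?_append_right (by simp [length, Walk.length])]
  simp [length, Walk.length]

theorem IsFactorization.vertex_mid (h : IsFactorization C F E D) (i : Fin (C.walk.length + 1))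
    (j : Fin (E.walk.length + 1)) (hij : i.val = D.length + j.val) :
    C.walk.vertex i = E.walk.vertex j := by
  obtain ⟨i, hi⟩ := i
  obtain ⟨j, hj⟩ := j
  obtain rfl : i = D.length + j := hij
  rcases j with _ | j
  -- At its first position `E` may have no letter to read the vertex from. It is the end of `D`,
  -- found from the last letter of `D` or, if `D` is lazy, from the start of `C`.
  · refine Eq.trans ?_ h.start_mid.symm
    by_cases h0 : D.walk.length = 0
    · rw [D.walk.finish_eq_start h0, h.start_left]
      exact congrArg C.walk.vertex (Fin.ext h0 : _ = (0 : Fin (C.walk.length + 1)))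
    · obtain ⟨n, hn⟩ := Nat.exists_eq_succ_of_ne_zero h0
      have h1 : n < D.walk.letters.length := by rw [Walk.length] at hn; omega
      have h2 := List.getElem?_eq_getElem h1
      rw [C.walk.vertex_succ ((h.getElem?_left h1).trans h2) _ hn, D.walk.finish_eq_tgt h2 hn]
  · have h1 : j < E.walk.letters.length := Nat.lt_of_succ_lt_succ hj
    have h2 := List.getElem?_eq_getElem h1
    rw [C.walk.vertex_succ ((h.getElem?_mid h1).trans h2) _ rfl, E.walk.vertex_succ h2 _ rfl]

theorem IsFactorization.inv (h : IsFactorization C F E D) :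
    IsFactorization C.inv D.inv E.inv F.inv where
  start_left := by
    have := h.length_eq
    change F.walk.finish = C.walk.finish
    -- The end of `C` is read from the last letter of `F`; for lazy `F` it is the end of `E`.
    by_cases h0 : F.walk.length = 0
    · rw [F.walk.finish_eq_start h0, h.start_right]
      refine (h.vertex_mid _ _ ?_).symm
      change C.length = D.length + E.length
      have h0 : F.length = 0 := h0
      omega
    · obtain ⟨n, hn⟩ := Nat.exists_eq_succ_of_ne_zero h0
      have h1 : n < F.walk.letters.length := by rw [Walk.length] at hn; omega
      have h2 := List.getElem?_eq_getElem h1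
      rw [F.walk.finish_eq_tgt h2 hn, C.walk.finish_eq_tgt ((h.getElem?_right n).trans h2)]
      have hn : F.length = n + 1 := hn
      change C.length = _
      omega
  start_mid := h.start_right.symm.trans F.walk.finish_inv.symm
  start_right := h.start_mid.symm.trans E.walk.finish_inv.symm
  letters_eq := by
    change invLetters _ = invLetters _ ++ invLetters _ ++ invLetters _
    rw [← invLetters_append, ← invLetters_append, ← List.append_assoc, h.letters_eq]

theorem IsQuotientFactorization.inv (h : IsQuotientFactorization C F E D) :
    IsQuotientFactorization C.inv D.inv E.inv F.inv where
  toIsFactorization := h.toIsFactorization.inv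
  last_left x hx := by
    change x ∈ (invLetters F.walk.letters).getLast? at hx
    rw [invLetters, List.getLast?_reverse, List.head?_map, Option.mem_map] at hx
    obtain ⟨y, hy, rfl⟩ := hx
    obtain ⟨α, rfl⟩ := h.head_right y hy
    exact ⟨α, rfl⟩
  head_right x hx := by
    change x ∈ (invLetters D.walk.letters).head? at hx
    rw [invLetters, List.head?_reverse, List.getLast?_map, Option.mem_map] at hx
    obtain ⟨y, hy, rfl⟩ := hx
    obtain ⟨α, rfl⟩ := h.last_left y hy
    exact ⟨α, rfl⟩

theorem IsFactor.of_inv (h : IsFactor E C.inv) : IsFactor E C := by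
  obtain ⟨F, E', D, h1, h2⟩ := h
  refine ⟨D.inv, E'.inv, F.inv, ?_, ?_⟩
  · have h3 := h1.inv
    have h4 : C.inv.inv = C := Subtype.ext C.walk.inv_inv
    rwa [h4] at h3
  · rcases h2 with h2 | h2
    · exact Or.inr (congrArg Walk.inv h2)
    · exact Or.inl ((congrArg Walk.inv h2).trans E.walk.inv_inv)

/-! ### From supports to factorizations -/

/-- Position `q` of `Y` lies in a submodule substring of `Y` that is a factor of `X`, if it is
related by the support of a homomorphism to a position of `X` with no letters around the two
positions in opposite directions. -/
theorem exists_factor_of_not_matchOpposite {X Y : Str I} {N : ℕ → ℕ → Prop}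
    (h : IsSupport X.walk.letters Y.walk.letters N)
    (hv : ∀ (p : Fin (X.length + 1)) (q : Fin (Y.length + 1)), N p q →
      X.walk.vertex p = Y.walk.vertex q) {p q : ℕ}
    (hN : N p q) (ho : ¬ MatchOpposite X.walk.letters Y.walk.letters p q) :
    ∃ F E D : Str I, IsSubmoduleFactorization Y F E D ∧ IsFactor E X ∧
      D.length ≤ q ∧ q ≤ D.length + E.length := by
  obtain ⟨d, e, m, h1, h2, h3, h4, h5, h6, h7, h8, h9, h10⟩ :=
    h.exists_common X.2.reduced Y.2.reduced hN ho
  have h3 : d + m ≤ X.length := h3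
  have h4 : e + m ≤ Y.length := h4
  obtain ⟨n, hn⟩ := Nat.exists_eq_add_of_le h3
  obtain ⟨n', hn'⟩ := Nat.exists_eq_add_of_le h4
  have last : ∀ (C : Str I) (a : ℕ) (ha : 0 + a ≤ C.length) (P : Letter V → Prop),
      (∀ d' x, a = d' + 1 → C.walk.letters[d']? = some x → P x) →
      ∀ x ∈ (C.sub 0 a ha).walk.letters.getLast?, P x := by
    intro C a ha P hP x hx
    have hl : (C.sub 0 a ha).walk.letters.length = a := C.length_sub 0 a ha
    rw [List.getLast?_eq_getElem?, hl, Option.mem_def] at hx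
    -- For `a = 0` the subtraction is truncated, but then the initial part is empty and has no last
    -- letter.
    have h0 : a - 1 < a := by
      have := (List.getElem?_eq_some_iff.1 hx).1
      omega
    refine hP (a - 1) x (by omega) ?_
    rw [← hx]
    exact ((C.walk.getElem?_letters_sub ha h0).trans (by rw [zero_add])).symm
  have head : ∀ (C : Str I) (a n : ℕ) (ha : a + n ≤ C.length) (P : Letter V → Prop),
      (∀ x, C.walk.letters[a]? = some x → P x) →
      ∀ x ∈ (C.sub a n ha).walk.letters.head?, P x := by
    intro C a n ha P hP x hx
    have hl : (C.sub a n ha).walk.letters.length = n := C.length_sub a n ha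
    rw [List.head?_eq_getElem?, Option.mem_def] at hx
    have h0 : 0 < n := by
      have := (List.getElem?_eq_some_iff.1 hx).1
      omega
    refine hP x ?_
    rw [← hx]
    exact (C.walk.getElem?_letters_sub ha h0).symm
  refine ⟨_, _, _, ⟨Y.isFactorization_sub hn'.symm, ?_, ?_⟩, ⟨_, _, _,
    ⟨X.isFactorization_sub hn.symm, ?_, ?_⟩, Or.inl ?_⟩, ?_, ?_⟩
  · exact last Y e _ _ h10
  · exact head Y _ _ _ _ h8
  · exact last X d _ _ h9
  · exact head X _ _ _ _ h7
  -- Equal letters do not identify lazy strings; the start vertices agree because `(d, e)` still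
  -- lies in the support.
  · refine Walk.ext (hv ⟨d, by omega⟩ ⟨e, by omega⟩ h5) (List.ext_getElem? fun i => ?_)
    by_cases hi : i < m
    · exact ((X.walk.getElem?_letters_sub h3 hi).trans (h6 i hi)).trans
        (Y.walk.getElem?_letters_sub h4 hi).symm
    · rw [List.getElem?_eq_none, List.getElem?_eq_none]
      · exact (Y.length_sub e m h4).le.trans (by omega)
      · exact (X.length_sub d m h3).le.trans (by omega)
  · simpa using h1
  · simpa using h2

/-- An opposite match at `(p, q)` excludes a match in the same direction. After inverting `X` the
pair therefore has no opposite match, and being a factor does not depend on the direction in which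
`X` is read. -/
theorem exists_factor {X Y : Str I} {N : ℕ → ℕ → Prop}
    (h : IsSupport X.walk.letters Y.walk.letters N)
    (hv : ∀ (p : Fin (X.length + 1)) (q : Fin (Y.length + 1)), N p q →
      X.walk.vertex p = Y.walk.vertex q) {p q : ℕ} (hN : N p q) :
    ∃ F E D : Str I, IsSubmoduleFactorization Y F E D ∧ IsFactor E X ∧
      D.length ≤ q ∧ q ≤ D.length + E.length := by
  by_cases ho : MatchOpposite X.walk.letters Y.walk.letters p q
  · have hp := (h.le hN).1
    have hs := not_matchSame_of_matchOpposite X.2.reduced Y.2.reduced ho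
    have hv' : ∀ (i : Fin (X.inv.length + 1)) (j : Fin (Y.length + 1)),
        (∃ i', i.val + i' = X.walk.letters.length ∧ N i' j) →
        X.inv.walk.vertex i = Y.walk.vertex j := by
      rintro i j ⟨i', h1, h2⟩
      have h3 : i.val + i' = X.walk.length := h1
      rw [← hv ⟨i', by change i' < X.walk.length + 1; omega⟩ j h2]
      exact X.walk.vertex_inv i _ h3
    obtain ⟨F, E, D, h1, h2, h3⟩ := exists_factor_of_not_matchOpposite (X := X.inv) (Y := Y)
      h.invLetters hv' (p := X.length - p) (q := q) ⟨p, Nat.sub_add_cancel hp, hN⟩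
      fun h' => hs (matchSame_of_matchOpposite_invLetters (Nat.sub_add_cancel hp) h')
    exact ⟨F, E, D, h1, h2.of_inv, h3⟩
  · exact exists_factor_of_not_matchOpposite h hv hN ho

end Str

end

section

variable {k : Type w} {V : Type u} [Field k] [Quiver.{v} V] [Fintype V]
  {I : TwoSidedIdeal (PathAlgebra k V)}

/-! ### Homomorphisms between string modules -/

namespace StringModule

/-- The basis vector of the string module at a position. -/
noncomputable def basisVector (C : Str I) (i : Fin (C.length + 1)) : StringModule C :=
  (Pi.single i 1 : Fin (C.length + 1) → k)

/-- The coordinate of an element of the string module at a position. -/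
def coord {C : Str I} (i : Fin (C.length + 1)) : StringModule C →ₗ[k] k :=
  LinearMap.proj (R := k) (φ := fun _ : Fin (C.length + 1) => k) i

theorem coord_basisVector {C : Str I} (i j : Fin (C.length + 1)) :
    coord i (basisVector C j) = if i = j then 1 else 0 :=
  Pi.single_apply j (1 : k) i

theorem ext_coord {C : Str I} {m m' : StringModule C} (h : ∀ i, coord i m = coord i m') : m = m' :=
  funext h

theorem eq_sum_smul_basisVector (C : Str I) (m : StringModule C) :
    m = ∑ i, coord i m • basisVector C i := by
  refine (pi_eq_sum_univ' (R := k) (show Fin (C.length + 1) → k from m)).trans ?_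
  refine Finset.sum_congr rfl fun i _ => congrArg _ (funext fun j => ?_)
  simp [basisVector, Pi.single_apply, eq_comm]

variable [IsAdmissibleMonomial I]

theorem mk_smul (C : Str I) (x : PathAlgebra k V) (m : Fin (C.length + 1) → k) :
    (Ideal.Quotient.mk I.asIdeal x : BoundAlgebra I) • (show StringModule C from m) =
      (C.walk.rep k x).mulVec m := rfl

/-- Scalars of `k` act through the algebra, so submodules and homomorphisms over `BoundAlgebra I`
are compatible with coordinates over `k`. -/
theorem mk_algebraMap_smul (C : Str I) (c : k) (m : StringModule C) :
    (Ideal.Quotient.mk I.asIdeal (algebraMap k (PathAlgebra k V) c) : BoundAlgebra I) • m =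
      c • m := by
  refine (mk_smul C _ m).trans ?_
  rw [AlgHom.commutes, Algebra.algebraMap_eq_smul_one]
  exact (Matrix.smul_mulVec c _ _).trans (congrArg (c • ·) (Matrix.one_mulVec _))

theorem submodule_eq_top (C : Str I) (S : Submodule (BoundAlgebra I) (StringModule C))
    (h : ∀ i, basisVector C i ∈ S) : S = ⊤ := by
  refine (Submodule.eq_top_iff').2 fun m => ?_
  rw [eq_sum_smul_basisVector C m]
  refine S.sum_mem fun i _ => ?_
  rw [← mk_algebraMap_smul]
  exact S.smul_mem _ (h i)

instance finite (C : Str I) : Module.Finite (BoundAlgebra I) (StringModule C) :=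
  Module.Finite.of_fg_top (by
    rw [← submodule_eq_top C (Submodule.span _ (Set.range (basisVector C)))
      fun i => Submodule.subset_span ⟨i, rfl⟩]
    exact Submodule.fg_span (Set.finite_range _))

/-- The class of an arrow in `kQ/I`. -/
noncomputable def arrowClass (I : TwoSidedIdeal (PathAlgebra k V)) (α : Quiver.Total V) :
    BoundAlgebra I := Ideal.Quotient.mk I.asIdeal (ofArrow k α)

/-- The class of a trivial path in `kQ/I`. -/
noncomputable def vertexClass (I : TwoSidedIdeal (PathAlgebra k V)) (x : V) :
    BoundAlgebra I := Ideal.Quotient.mk I.asIdeal (ofPath k ⟨x, x, Quiver.Path.nil⟩)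

theorem arrowClass_smul (C : Str I) (α : Quiver.Total V) (m : Fin (C.length + 1) → k) :
    arrowClass I α • (show StringModule C from m) = (C.walk.arrowMatrix k α).mulVec m := by
  refine (mk_ofPath_smul C _ m).trans ?_
  exact congrArg (Matrix.mulVec · m) (C.walk.arrowMatrix_mul_vertexMatrix k α)

theorem coord_vertexClass_smul {C : Str I} (x : V) (m : StringModule C)
    (i : Fin (C.walk.length + 1)) (h : C.walk.vertex i ≠ x) :
    coord i (vertexClass I x • m) = 0 := by
  refine (congrFun (mk_ofPath_smul C _ m) i).trans ?_
  refine (Matrix.mulVec_diagonal _ _ _).trans ?_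
  rw [if_neg h, zero_mul]

theorem vertexClass_smul_basisVector (C : Str I) (i : Fin (C.walk.length + 1)) :
    vertexClass I (C.walk.vertex i) • basisVector C i = basisVector C i := by
  refine (mk_ofPath_smul C _ _).trans (funext fun j => ?_)
  refine (Matrix.mulVec_diagonal _ _ _).trans ?_
  by_cases h : j = i
  · subst h; rw [if_pos rfl, one_mul]
  · have : basisVector C i j = 0 := Pi.single_eq_of_ne h 1
    rw [this, mul_zero]

open Classical in
theorem coord_arrowClass_smul {C : Str I} (α : Quiver.Total V) (m : StringModule C)
    (j : Fin (C.length + 1)) :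
    coord j (arrowClass I α • m) =
      ∑ i : Fin (C.length + 1), if ArrowAt C.walk.letters α i j then coord i m else 0 := by
  refine (congrFun (arrowClass_smul C α m) j).trans ?_
  refine Eq.trans (b := ∑ i : Fin (C.length + 1), C.walk.arrowMatrix k α j i * coord i m) rfl ?_
  refine Finset.sum_congr rfl fun i _ => (ite_mul (α := k) _ _ _ _).trans ?_
  rw [one_mul, zero_mul]
  rfl

theorem arrowClass_smul_basisVector {C : Str I} {α : Quiver.Total V} {i j : Fin (C.length + 1)}
    (h : ArrowAt C.walk.letters α i j) :
    arrowClass I α • basisVector C i = basisVector C j := by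
  classical
  refine ext_coord fun l => ?_
  rw [coord_arrowClass_smul, Finset.sum_eq_single i]
  · rw [coord_basisVector, coord_basisVector, if_pos rfl]
    refine if_congr ⟨fun h' => Fin.ext (h'.target_unique C.2.reduced h), ?_⟩ rfl rfl
    rintro rfl
    exact h
  · intro b _ hb
    rw [coord_basisVector, if_neg hb, ite_self]
  · simp

theorem arrowClass_smul_basisVector_eq_zero {C : Str I} {α : Quiver.Total V}
    {i : Fin (C.length + 1)} (h : ∀ j : Fin (C.length + 1), ¬ ArrowAt C.walk.letters α i j) :
    arrowClass I α • basisVector C i = 0 := by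
  classical
  refine ext_coord fun l => ?_
  rw [coord_arrowClass_smul, map_zero]
  refine Finset.sum_eq_zero fun b _ => ?_
  by_cases hb : b = i
  · subst hb; rw [if_neg (h l)]
  · rw [coord_basisVector, if_neg hb, ite_self]

/-- The support of a homomorphism between string modules. -/
def Support {C D : Str I} (φ : StringModule C →ₗ[BoundAlgebra I] StringModule D) (p q : ℕ) : Prop :=
  ∃ (i : Fin (C.length + 1)) (j : Fin (D.length + 1)), i.val = p ∧ j.val = q ∧
    coord j (φ (basisVector C i)) ≠ 0

/-- For `lift`, b_p = α b_{p'}, so the coefficient of α φ(b_{p'}) at q is nonzero, and some arrow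
into q must contribute to it. For `descend`, the only arrow `α` into q' starts at q, so α φ(b_p) has
at q' the nonzero coefficient of φ(b_p) at q. Hence α b_p ≠ 0, that is, an arrow `α` leaves p. -/
theorem isSupport {C D : Str I} (φ : StringModule C →ₗ[BoundAlgebra I] StringModule D) :
    IsSupport C.walk.letters D.walk.letters (Support φ) where
  le := by
    rintro _ _ ⟨i, j, rfl, rfl, -⟩
    exact ⟨Nat.le_of_lt_succ i.2, Nat.le_of_lt_succ j.2⟩
  lift := by
    classical
    rintro _ _ p' α ⟨i, j, rfl, rfl, h⟩ h1
    let i' : Fin (C.length + 1) := ⟨p', Nat.lt_succ_of_le h1.le_length.1⟩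
    have h1 : ArrowAt C.walk.letters α i' i := h1
    rw [← arrowClass_smul_basisVector h1, map_smul, coord_arrowClass_smul] at h
    obtain ⟨j', -, h2⟩ := Finset.exists_ne_zero_of_sum_ne_zero h
    rw [ite_ne_right_iff] at h2
    exact ⟨j', h2.1, i', j', rfl, rfl, h2.2⟩
  descend := by
    classical
    rintro _ _ q' α ⟨i, j, rfl, rfl, h⟩ h1
    let j' : Fin (D.length + 1) := ⟨q', Nat.lt_succ_of_le h1.le_length.2⟩
    have h1 : ArrowAt D.walk.letters α j j' := h1
    have h2 : coord j' (φ (arrowClass I α • basisVector C i)) ≠ 0 := by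
      rw [map_smul, coord_arrowClass_smul, Finset.sum_eq_single j]
      · rwa [if_pos h1]
      · intro l _ hl
        exact if_neg fun h3 => hl (Fin.ext (h3.source_unique D.2.reduced h1))
      · simp
    by_cases h3 : ∃ i' : Fin (C.length + 1), ArrowAt C.walk.letters α i i'
    · obtain ⟨i', h3⟩ := h3
      rw [arrowClass_smul_basisVector h3] at h2
      exact ⟨i', h3, i', j', rfl, rfl, h2⟩
    · rw [arrowClass_smul_basisVector_eq_zero (not_exists.1 h3), map_zero, map_zero] at h2
      exact absurd rfl h2

theorem vertex_eq_of_coord_ne_zero {C D : Str I}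
    (φ : StringModule C →ₗ[BoundAlgebra I] StringModule D) (i : Fin (C.walk.length + 1))
    (j : Fin (D.walk.length + 1)) (h : coord j (φ (basisVector C i)) ≠ 0) :
    C.walk.vertex i = D.walk.vertex j := by
  by_contra hne
  refine h ?_
  rw [← vertexClass_smul_basisVector, map_smul]
  exact coord_vertexClass_smul _ _ _ (Ne.symm hne)

theorem exists_factor_of_coord_ne_zero {C D : Str I}
    (φ : StringModule C →ₗ[BoundAlgebra I] StringModule D) (i : Fin (C.length + 1))
    (j : Fin (D.length + 1)) (h : coord j (φ (basisVector C i)) ≠ 0) :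
    ∃ F E G : Str I, Str.IsSubmoduleFactorization D F E G ∧ Str.IsFactor E C ∧
      G.length ≤ j ∧ j ≤ G.length + E.length := by
  refine Str.exists_factor (isSupport φ) ?_ ⟨i, j, rfl, rfl, h⟩
  rintro p q ⟨i, j, hi, hj, h⟩
  obtain rfl := Fin.ext hi
  obtain rfl := Fin.ext hj
  exact vertex_eq_of_coord_ne_zero φ _ _ h

/-! ### Homomorphisms given by relations between positions -/

open Classical in
-- Uniqueness of the middle index leaves at most one nonzero summand in each entry, so the product
-- of 0/1 matrices is again 0/1 over any field.
theorem mul_indicatorMatrix {l m n : Type*} [Fintype m] {P : l → m → Prop} {Q : m → n → Prop}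
    {S : l → n → Prop} (hS : ∀ i j, S i j ↔ ∃ b, P i b ∧ Q b j)
    (h : ∀ i j b b', P i b → Q b j → P i b' → Q b' j → b = b') :
    (Matrix.of fun i j => if P i j then (1 : k) else 0) *
      (Matrix.of fun i j => if Q i j then (1 : k) else 0) =
      Matrix.of fun i j => if S i j then (1 : k) else 0 := by
  ext i j
  rw [Matrix.mul_apply]
  simp only [Matrix.of_apply]
  split_ifs with h0
  · obtain ⟨b, h1, h2⟩ := (hS i j).1 h0
    rw [Finset.sum_eq_single b]
    · simp [h1, h2]
    · intro b' _ hb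
      by_cases h3 : P i b'
      · rw [if_neg (fun h4 => hb (h i j _ _ h3 h4 h1 h2)), mul_zero]
      · rw [if_neg h3, zero_mul]
    · simp
  · refine Finset.sum_eq_zero fun b _ => ?_
    by_cases h3 : P i b
    · rw [if_neg fun h4 => h0 ((hS i j).2 ⟨b, h3, h4⟩), mul_zero]
    · rw [if_neg h3, zero_mul]

/-- A matrix that commutes with the actions of the trivial paths and the arrows defines a
homomorphism of string modules. -/
theorem exists_hom_of_matrix {C D : Str I}
    (G : Matrix (Fin (D.walk.length + 1)) (Fin (C.walk.length + 1)) k)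
    (hv : ∀ x, G * C.walk.vertexMatrix k x = D.walk.vertexMatrix k x * G)
    (ha : ∀ α, G * C.walk.arrowMatrix k α = D.walk.arrowMatrix k α * G) :
    ∃ g : StringModule C →ₗ[BoundAlgebra I] StringModule D, ∀ m, g m = G.mulVec m := by
  have hp : ∀ {a b : V} (p : Quiver.Path a b),
      G * C.walk.pathMatrix k p = D.walk.pathMatrix k p * G := by
    intro a b p
    induction p with
    | nil => exact hv a
    | cons p α ih =>
      rw [Walk.pathMatrix, Walk.pathMatrix, ← Matrix.mul_assoc, ha, Matrix.mul_assoc, ih,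
        Matrix.mul_assoc]
  have hx : ∀ x : PathAlgebra k V, G * C.walk.rep k x = D.walk.rep k x * G := by
    -- Both sides are linear in `x`, so the equality on paths extends to the whole path algebra.
    let f₁ : PathAlgebra k V →ₗ[k] Matrix (Fin (D.walk.length + 1)) (Fin (C.walk.length + 1)) k :=
      { toFun := fun x => G * C.walk.rep k x
        map_add' := fun x y => by rw [map_add, Matrix.mul_add]
        map_smul' := fun c x => by rw [map_smul, Matrix.mul_smul, RingHom.id_apply] }
    let f₂ : PathAlgebra k V →ₗ[k] Matrix (Fin (D.walk.length + 1)) (Fin (C.walk.length + 1)) k :=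
      { toFun := fun x => D.walk.rep k x * G
        map_add' := fun x y => by rw [map_add, Matrix.add_mul]
        map_smul' := fun c x => by rw [map_smul, Matrix.smul_mul, RingHom.id_apply] }
    have : f₁ = f₂ := hom_ext fun p => by
      change G * C.walk.rep k _ = D.walk.rep k _ * G
      rw [Walk.rep_ofPath, Walk.rep_ofPath, hp]
    exact LinearMap.congr_fun this
  refine ⟨{ toFun := fun m => G.mulVec m
            map_add' := fun x y => Matrix.mulVec_add G x y
            map_smul' := fun a m => ?_ }, fun m => rfl⟩
  obtain ⟨x, rfl⟩ := Ideal.Quotient.mk_surjective a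
  change G.mulVec ((C.walk.rep k x).mulVec m) = (D.walk.rep k x).mulVec (G.mulVec m)
  refine (Matrix.mulVec_mulVec _ _ _).trans (Eq.trans ?_ (Matrix.mulVec_mulVec _ _ _).symm)
  rw [hx]

/-- A partial bijection between the positions of two strings which is compatible with the vertices
and the arrows defines a homomorphism of string modules. -/
theorem exists_hom_of_isSupport {C D : Str I} {R : ℕ → ℕ → Prop}
    (h : IsSupport C.walk.letters D.walk.letters R)
    (hv : ∀ (p : Fin (C.walk.length + 1)) (q : Fin (D.walk.length + 1)), R p q →
      C.walk.vertex p = D.walk.vertex q)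
    (hl : ∀ p p' q, R p q → R p' q → p = p') (hr : ∀ p q q', R p q → R p q' → q = q') :
    ∃ g : StringModule C →ₗ[BoundAlgebra I] StringModule D,
      ∀ i j, R i.val j.val → g (basisVector C i) = basisVector D j := by
  classical
  let G : Matrix (Fin (D.walk.length + 1)) (Fin (C.walk.length + 1)) k :=
    Matrix.of fun q p => if R p q then 1 else 0
  have hGv : ∀ x, G * C.walk.vertexMatrix k x = D.walk.vertexMatrix k x * G := by
    intro x
    ext q p
    rw [Walk.vertexMatrix, Walk.vertexMatrix, Matrix.mul_diagonal, Matrix.diagonal_mul]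
    by_cases hpq : R p q
    · rw [hv p q hpq, mul_comm]
    · simp [G, hpq]
  have hGa : ∀ α, G * C.walk.arrowMatrix k α = D.walk.arrowMatrix k α * G := by
    intro α
    -- Both products are the 0/1 matrix of the relation "arrow first, then `R`". The clauses `lift`
    -- and `descend` say that it equals "`R` first, then arrow"; `hl` and `hr` make the middle index
    -- unique.
    let S : Fin (D.walk.length + 1) → Fin (C.walk.length + 1) → Prop :=
      fun q' p => ∃ p' : Fin (C.walk.length + 1), R p' q' ∧ C.walk.HasArrow α p p'
    refine (mul_indicatorMatrix (S := S) (fun _ _ => Iff.rfl) ?_).trans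
      (mul_indicatorMatrix (S := S) (fun q' p => ⟨?_, ?_⟩) ?_).symm
    · intro i j b b' h1 _ h2 _
      exact Fin.ext (hl _ _ _ h1 h2)
    · rintro ⟨p', h1, h2⟩
      obtain ⟨q, h3, h4⟩ := h.lift h1 h2
      exact ⟨⟨q, Nat.lt_succ_of_le (h.le h4).2⟩, h3, h4⟩
    · rintro ⟨q, h1, h2⟩
      obtain ⟨p', h3, h4⟩ := h.descend h2 h1
      exact ⟨⟨p', Nat.lt_succ_of_le (h.le h4).1⟩, h4, h3⟩
    · intro i j b b' _ h1 _ h2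
      exact Fin.ext (hr _ _ _ h1 h2)
  obtain ⟨g, hg⟩ := exists_hom_of_matrix G hGv hGa
  refine ⟨g, fun i j hij => ?_⟩
  rw [hg]
  refine (Matrix.mulVec_single_one G i).trans (ext_coord fun q => ?_)
  have hiff : R i q ↔ q = j := by
    refine ⟨fun h' => Fin.ext (hr _ _ _ h' hij), ?_⟩
    rintro rfl
    exact hij
  refine Eq.trans ?_ (coord_basisVector q j).symm
  change (if R i q then (1 : k) else 0) = _
  simp only [hiff]

theorem exists_hom_inv (C : Str I) :
    ∃ g : StringModule C →ₗ[BoundAlgebra I] StringModule C.inv,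
      ∀ i j, i.val + j.val = C.length → g (basisVector C i) = basisVector C.inv j := by
  refine exists_hom_of_isSupport (R := fun p q => p + q = C.length) ?_ ?_ ?_ ?_
  · have hlen : C.inv.walk.letters.length = C.length := C.walk.length_inv
    have hlen' : C.walk.letters.length = C.length := rfl
    refine ⟨fun h => by omega, fun {p q p' α} h1 h2 => ?_, fun {p q q' α} h1 h2 => ?_⟩
    · have h3 := h2.le_length.1
      exact ⟨C.length - p', h2.invLetters (by omega) (by omega), by omega⟩
    · have h3 := h2.le_length.2
      rw [hlen] at h3
      refine ⟨C.length - q', (arrowAt_invLetters (i' := q) (j' := q') ?_ ?_).1 h2, ?_⟩ <;> omega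
  · intro p q h
    exact (C.walk.vertex_inv q p (by rw [add_comm]; exact h)).symm
  · intros; omega
  · intros; omega

end StringModule

/-! ### Inclusions of submodule substrings and projections onto factors -/

namespace Str

variable {C F E D : Str I}

theorem IsFactorization.arrowAt_mid (h : IsFactorization C F E D) {α : Quiver.Total V} {p p' : ℕ}
    (hp : p ≤ E.length) (hp' : p' ≤ E.length) :
    ArrowAt C.walk.letters α (D.length + p) (D.length + p') ↔ ArrowAt E.walk.letters α p p' := by
  have e1 : D.length + p' = D.length + p + 1 ↔ p' = p + 1 := by omega
  have e2 : D.length + p = D.length + p' + 1 ↔ p = p' + 1 := by omega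
  rw [ArrowAt, ArrowAt, e1, e2]
  refine or_congr (and_congr_right fun h1 => ?_) (and_congr_right fun h1 => ?_) <;>
    rw [h.getElem?_mid (by omega)]

/-- An arrow can leave the middle part only through a letter adjacent to it. A submodule
factorization rules out both exits; dually, a quotient factorization rules out both entrances listed
in `arrow_target`. -/
theorem IsFactorization.arrow_source (h : IsFactorization C F E D) {α : Quiver.Total V} {p q : ℕ}
    (hp : p ≤ E.length) (h1 : ArrowAt C.walk.letters α (D.length + p) q) :
    (∃ p' ≤ E.length, q = D.length + p') ∨ Letter.inverse α ∈ D.walk.letters.getLast? ∨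
      Letter.direct α ∈ F.walk.letters.head? := by
  rcases h1 with ⟨rfl, h1⟩ | ⟨h2, h1⟩
  · rcases hp.lt_or_eq with hp | rfl
    · exact Or.inl ⟨p + 1, hp, rfl⟩
    · refine Or.inr (Or.inr ?_)
      rwa [List.head?_eq_getElem?, ← h.getElem?_right 0]
  · rcases p with _ | p
    · refine Or.inr (Or.inl ?_)
      rw [List.getLast?_eq_getElem?, Option.mem_def, ← h.getElem?_left]
      · rwa [show D.walk.letters.length - 1 = q by change D.length - 1 = q; omega]
      · change D.length - 1 < D.length; omega
    · exact Or.inl ⟨p, by omega, by omega⟩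

theorem IsFactorization.arrow_target (h : IsFactorization C F E D) {α : Quiver.Total V} {p q : ℕ}
    (hp : p ≤ E.length) (h1 : ArrowAt C.walk.letters α q (D.length + p)) :
    (∃ p' ≤ E.length, q = D.length + p') ∨ Letter.direct α ∈ D.walk.letters.getLast? ∨
      Letter.inverse α ∈ F.walk.letters.head? := by
  rcases h1 with ⟨h2, h1⟩ | ⟨rfl, h1⟩
  · rcases p with _ | p
    · refine Or.inr (Or.inl ?_)
      rw [List.getLast?_eq_getElem?, Option.mem_def, ← h.getElem?_left]
      · rwa [show D.walk.letters.length - 1 = q by change D.length - 1 = q; omega]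
      · change D.length - 1 < D.length; omega
    · exact Or.inl ⟨p, by omega, by omega⟩
  · rcases hp.lt_or_eq with hp | rfl
    · exact Or.inl ⟨p + 1, hp, rfl⟩
    · refine Or.inr (Or.inr ?_)
      rwa [List.head?_eq_getElem?, ← h.getElem?_right 0]

theorem IsSubmoduleFactorization.isSupport (h : IsSubmoduleFactorization C F E D) :
    IsSupport E.walk.letters C.walk.letters fun p q => q = D.length + p ∧ p ≤ E.length where
  le := by
    rintro p q ⟨rfl, h1⟩
    have := h.length_eq
    exact ⟨h1, by change _ ≤ C.length; omega⟩
  lift := by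
    rintro p q p' α ⟨rfl, h1⟩ h2
    have h3 := h2.le_length.1
    exact ⟨D.length + p', (h.arrowAt_mid h3 h1).2 h2, rfl, h3⟩
  descend := by
    rintro p q q' α ⟨rfl, h1⟩ h2
    rcases h.arrow_source h1 h2 with ⟨p', h3, rfl⟩ | h3 | h3
    · exact ⟨p', (h.arrowAt_mid h1 h3).1 h2, rfl, h3⟩
    · obtain ⟨β, hβ⟩ := h.last_left _ h3
      cases hβ
    · obtain ⟨β, hβ⟩ := h.head_right _ h3
      cases hβ

theorem IsQuotientFactorization.isSupport (h : IsQuotientFactorization C F E D) :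
    IsSupport C.walk.letters E.walk.letters fun p q => p = D.length + q ∧ q ≤ E.length where
  le := by
    rintro p q ⟨rfl, h1⟩
    have := h.length_eq
    exact ⟨by change _ ≤ C.length; omega, h1⟩
  lift := by
    rintro p q p' α ⟨rfl, h1⟩ h2
    rcases h.arrow_target h1 h2 with ⟨q', h3, rfl⟩ | h3 | h3
    · exact ⟨q', (h.arrowAt_mid h3 h1).1 h2, rfl, h3⟩
    · obtain ⟨β, hβ⟩ := h.last_left _ h3
      cases hβ
    · obtain ⟨β, hβ⟩ := h.head_right _ h3
      cases hβ
  descend := by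
    rintro p q q' α ⟨rfl, h1⟩ h2
    have h3 := h2.le_length.2
    exact ⟨D.length + q', (h.arrowAt_mid h1 h3).2 h2, rfl, h3⟩

/-- The inclusion of a submodule substring. -/
theorem IsSubmoduleFactorization.exists_hom [IsAdmissibleMonomial I]
    (h : IsSubmoduleFactorization C F E D) :
    ∃ g : StringModule E →ₗ[BoundAlgebra I] StringModule C, ∀ i j, j.val = D.length + i.val →
      g (StringModule.basisVector E i) = StringModule.basisVector C j := by
  obtain ⟨g, hg⟩ := StringModule.exists_hom_of_isSupport h.isSupport
    (fun p q h1 => (h.vertex_mid q p h1.1).symm) (fun _ _ _ _ _ => by omega)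
    (fun _ _ _ _ _ => by omega)
  exact ⟨g, fun i j hij => hg i j ⟨hij, Nat.le_of_lt_succ i.2⟩⟩

/-- The projection onto a factor substring. -/
theorem IsQuotientFactorization.exists_hom [IsAdmissibleMonomial I]
    (h : IsQuotientFactorization C F E D) :
    ∃ g : StringModule C →ₗ[BoundAlgebra I] StringModule E, ∀ i j, j.val = D.length + i.val →
      g (StringModule.basisVector C j) = StringModule.basisVector E i := by
  obtain ⟨g, hg⟩ := StringModule.exists_hom_of_isSupport h.isSupport
    (fun p q h1 => h.vertex_mid p q h1.1) (fun _ _ _ _ _ => by omega)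
    (fun _ _ _ _ _ => by omega)
  exact ⟨g, fun i j hij => hg j i ⟨hij, Nat.le_of_lt_succ i.2⟩⟩

/-- The string module of a factor is a quotient. -/
theorem IsFactor.exists_hom [IsAdmissibleMonomial I] (h : IsFactor E C) :
    ∃ g : StringModule C →ₗ[BoundAlgebra I] StringModule E, ∀ i, ∃ j,
      g (StringModule.basisVector C j) = StringModule.basisVector E i := by
  obtain ⟨F, E', D, h1, h2⟩ := h
  obtain ⟨g, hg⟩ := h1.exists_hom
  have hlen := h1.length_eq
  rcases h2 with h2 | h2
  · obtain rfl : E' = E := Subtype.ext h2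
    exact ⟨g, fun i => ⟨⟨D.length + i, by omega⟩, hg _ _ rfl⟩⟩
  · obtain rfl : E = E'.inv :=
      Subtype.ext (E.walk.inv_inv.symm.trans (congrArg Walk.inv h2.symm))
    obtain ⟨g', hg'⟩ := StringModule.exists_hom_inv E'
    have hl : E'.inv.length = E'.length := E'.walk.length_inv
    -- Position `i` of the inverse string is position `E'.length - i` of `E'`.
    refine ⟨g'.comp g, fun i => ⟨⟨D.length + (E'.length - i), by omega⟩, ?_⟩⟩
    rw [LinearMap.comp_apply, hg ⟨E'.length - i, by omega⟩ _ rfl]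
    exact hg' _ _ (Nat.sub_add_cancel (by omega))

theorem exists_hom_of_isFactor [IsAdmissibleMonomial I] {X : Str I}
    (h : IsSubmoduleFactorization C F E D) (h' : IsFactor E X) (q : Fin (C.length + 1))
    (h1 : D.length ≤ q) (h2 : q ≤ D.length + E.length) :
    ∃ g : StringModule X →ₗ[BoundAlgebra I] StringModule C, ∃ j,
      g (StringModule.basisVector X j) = StringModule.basisVector C q := by
  obtain ⟨g, hg⟩ := h.exists_hom
  obtain ⟨g', hg'⟩ := h'.exists_hom
  obtain ⟨j, hj⟩ := hg' ⟨q - D.length, by omega⟩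
  refine ⟨g.comp g', j, ?_⟩
  rw [LinearMap.comp_apply, hj]
  exact hg _ _ (Nat.add_sub_cancel' h1).symm

/-- A submodule substring contains every arrow of the string that starts in it; so the arrows are
covered as soon as the positions are. -/
theorem isUnion_of_forall_position {𝒮 : Set (Str I × Str I × Str I)}
    (h𝒮 : ∀ F E D : Str I, (F, E, D) ∈ 𝒮 → IsSubmoduleFactorization C F E D)
    (h : ∀ i : ℕ, i ≤ C.length → ∃ T ∈ 𝒮, T.2.2.length ≤ i ∧ i ≤ T.2.2.length + T.2.1.length) :
    IsUnion C 𝒮 := by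
  refine ⟨h, fun i hi => ?_⟩
  have h0 := List.getElem?_eq_getElem (l := C.walk.letters) hi
  generalize C.walk.letters[i] = x at h0
  have key : ∀ α p q, ArrowAt C.walk.letters α p q → ∃ T ∈ 𝒮,
      (T.2.2.length ≤ p ∧ p ≤ T.2.2.length + T.2.1.length) ∧
      (T.2.2.length ≤ q ∧ q ≤ T.2.2.length + T.2.1.length) := by
    intro α p q hα
    obtain ⟨⟨F, E, D⟩, hT, h1, h2⟩ := h p hα.le_length.1
    have hs := h𝒮 F E D hT
    refine ⟨_, hT, ⟨h1, h2⟩, ?_⟩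
    obtain ⟨p, rfl⟩ := Nat.exists_eq_add_of_le h1
    rcases hs.arrow_source (Nat.le_of_add_le_add_left h2) hα with ⟨p', h3, rfl⟩ | h3 | h3
    · exact ⟨Nat.le_add_right _ _, Nat.add_le_add_left h3 _⟩
    · obtain ⟨β, hβ⟩ := hs.last_left _ h3
      cases hβ
    · obtain ⟨β, hβ⟩ := hs.head_right _ h3
      cases hβ
  rcases x with α | α
  · obtain ⟨T, hT, h1, h2⟩ := key α i (i + 1) (Or.inl ⟨rfl, h0⟩)
    exact ⟨T, hT, h1.1, h2.2⟩
  · obtain ⟨T, hT, h1, h2⟩ := key α (i + 1) i (Or.inr ⟨rfl, h0⟩)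
    exact ⟨T, hT, h2.1, h1.2⟩

end Str

/-! ### The modules generated by a direct sum of string modules -/

variable [IsAdmissibleMonomial I] {ι : Type*} (X : ι → Str I) (Y : Str I)

/-- If the coordinate at `q` vanished on the images of all basis vectors, it would vanish on the
image of each M(X_i), hence of their direct sum and of its finite powers. But `f` reaches the basis
vector at `q`. -/
theorem exists_coord_ne_zero_of_surjective {n : ℕ}
    (f : (Fin n → DirectSum ι fun i => StringModule (X i)) →ₗ[BoundAlgebra I] StringModule Y)
    (hf : Function.Surjective f) (q : Fin (Y.length + 1)) :
    ∃ (i : ι) (φ : StringModule (X i) →ₗ[BoundAlgebra I] StringModule Y) (p : _),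
      StringModule.coord q (φ (StringModule.basisVector (X i) p)) ≠ 0 := by
  classical
  by_contra! h
  have h1 : ∀ (i : ι) (φ : StringModule (X i) →ₗ[BoundAlgebra I] StringModule Y) (m),
      StringModule.coord q (φ m) = 0 := by
    intro i φ m
    rw [StringModule.eq_sum_smul_basisVector _ m, map_sum, map_sum]
    refine Finset.sum_eq_zero fun p _ => ?_
    rw [← StringModule.mk_algebraMap_smul, map_smul, StringModule.mk_algebraMap_smul, map_smul,
      h, smul_zero]
  have h2 : ∀ (φ : (DirectSum ι fun i => StringModule (X i)) →ₗ[BoundAlgebra I] StringModule Y) (m),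
      StringModule.coord q (φ m) = 0 := by
    intro φ m
    induction m using DirectSum.induction_on with
    | zero => rw [map_zero, map_zero]
    | of i x => exact h1 i (φ.comp (DirectSum.lof (BoundAlgebra I) ι (fun i => StringModule (X i)) i)) x
    | add x y hx hy => rw [map_add, map_add, hx, hy, add_zero]
  obtain ⟨m, hm⟩ := hf (StringModule.basisVector Y q)
  have h3 : StringModule.coord q (f m) = 0 := by
    rw [← Finset.univ_sum_single m, map_sum, map_sum]
    exact Finset.sum_eq_zero fun a _ => h2 (f.comp (LinearMap.single (BoundAlgebra I)
      (fun _ => DirectSum ι fun i => StringModule (X i)) a)) (m a)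
  rw [hm, StringModule.coord_basisVector, if_pos rfl] at h3
  exact one_ne_zero h3

theorem inFac_of_forall_position
    (h : ∀ q : Fin (Y.length + 1), ∃ (i : ι)
      (g : StringModule (X i) →ₗ[BoundAlgebra I] StringModule Y) (j : _),
      g (StringModule.basisVector (X i) j) = StringModule.basisVector Y q) :
    InFac (BoundAlgebra I) (DirectSum ι fun i => StringModule (X i)) (StringModule Y) := by
  classical
  choose i g j hg using h
  -- One copy of the direct sum is used for each position `q` of `Y`; that copy is projected to its
  -- summand `i q` and mapped by `g q`, so the positions are reached independently.
  refine ⟨inferInstance, Y.length + 1, ∑ q, (g q).comp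
    ((DirectSum.component (BoundAlgebra I) ι (fun i => StringModule (X i)) (i q)).comp (LinearMap.proj q)), ?_⟩
  rw [← LinearMap.range_eq_top]
  refine StringModule.submodule_eq_top Y _ fun q => ⟨Pi.single q
    (DirectSum.lof (BoundAlgebra I) ι (fun i => StringModule (X i)) (i q) (StringModule.basisVector (X (i q)) (j q))), ?_⟩
  rw [LinearMap.sum_apply, Finset.sum_eq_single q]
  · simp only [LinearMap.comp_apply, LinearMap.proj_apply, Pi.single_eq_same,
      DirectSum.component.lof_self, hg]
  · intro q' _ hq
    simp only [LinearMap.comp_apply, LinearMap.proj_apply, Pi.single_eq_of_ne hq, map_zero]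
  · simp

end

end GentleStrings

/-! ### The characterization of string modules in Fac X -/

theorem mainTheorem9 {k : Type*} [Field k] {V : Type*} [Quiver V] [Fintype V]
    (I : TwoSidedIdeal (GentleStrings.PathAlgebra k V)) [GentleStrings.IsGentle I]
    {ι : Type*} (X : ι → GentleStrings.Str I) (Y : GentleStrings.Str I) :
    GentleStrings.InFac (GentleStrings.BoundAlgebra I)
        (DirectSum ι fun i => GentleStrings.StringModule (X i)) (GentleStrings.StringModule Y) ↔
      ∃ 𝒮 : Set (GentleStrings.Str I × GentleStrings.Str I × GentleStrings.Str I),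
        (∀ F E D : GentleStrings.Str I, (F, E, D) ∈ 𝒮 →
          GentleStrings.Str.IsSubmoduleFactorization Y F E D ∧
            ∃ i : ι, GentleStrings.Str.IsFactor E (X i)) ∧
        GentleStrings.IsUnion Y 𝒮 := by
  constructor
  · rintro ⟨-, n, f, hf⟩
    -- The largest possible set is taken, so only the covering of positions remains to be shown.
    refine ⟨{T | GentleStrings.Str.IsSubmoduleFactorization Y T.1 T.2.1 T.2.2 ∧
      ∃ i : ι, GentleStrings.Str.IsFactor T.2.1 (X i)}, fun F E D h => h,
      GentleStrings.Str.isUnion_of_forall_position (fun F E D h => h.1) fun q hq => ?_⟩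
    obtain ⟨i, φ, p, h⟩ := GentleStrings.exists_coord_ne_zero_of_surjective X Y f hf
      ⟨q, Nat.lt_succ_of_le hq⟩
    obtain ⟨F, E, D, h1, h2, h3⟩ :=
      GentleStrings.StringModule.exists_factor_of_coord_ne_zero φ p _ h
    exact ⟨(F, E, D), ⟨h1, i, h2⟩, h3⟩
  · rintro ⟨𝒮, h𝒮, hu, -⟩
    refine GentleStrings.inFac_of_forall_position X Y fun q => ?_
    obtain ⟨⟨F, E, D⟩, hT, h1, h2⟩ := hu q (Nat.le_of_lt_succ q.2)
    obtain ⟨hs, i, hi⟩ := h𝒮 F E D hT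
    exact ⟨i, GentleStrings.Str.exists_hom_of_isFactor hs hi q h1 h2⟩
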